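/- A \emph{polyhedron} is a three-dimensional bounded convex polyhedron in $\mathbb{R}^3$. Let $P$ be a polyhedron and let $o$ be an interior point of $P$. A boundary point $q$ of $P$ is an \emph{equilibrium point} of $P$ with respect to $o$ if the plane $H$ through $q$ perpendicular to the segment $[o,q]$ supports $P$ at $q$. It is \emph{nondegenerate} if $H\cap P$ is the vertex, edge or face of $P$ that contains $q$ in its relative interior, and a nondegenerate equilibrium point is \emph{unstable} if $\dim(H\cap P)=0$. A \emph{0-skeleton} is a polyhedron carrying a unit mass at each of its vertices (and no other mass), so that its center of mass is the arithmetic mean of its vertices. It is \emph{mono-unstable} if it has exactly one unstable equilibrium point with respect to its center of mass. Every polyhedron with at least $11$ vertices has at least $8$ (two-dimensional) faces, and the minimum number of faces that a mono-unstable 0-skeleton may have is $8$: every mono-unstable 0-skeleton has at least $8$ faces, and there is one with exactly $8$ faces. -/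

import Mathlib

namespace MonoUnstable

/-- Euclidean three-space. -/
abbrev E3 : Type := EuclideanSpace ℝ (Fin 3)

/-- A polyhedron: the convex hull of a finite set of points of three-space that has interior points,
i.e. a bounded convex polyhedron of dimension three. -/
def IsPolyhedron (P : Set E3) : Prop :=
  ∃ S : Set E3, S.Finite ∧ P = convexHull ℝ S ∧ (interior P).Nonempty

/-- The vertices of `P` are its extreme points. -/
def vertices (P : Set E3) : Set E3 :=
  P.extremePoints ℝ

/-- A polyhedron has finitely many vertices, so the sums over the vertices below are genuine. -/
theorem IsPolyhedron.finite_vertices {P : Set E3} (hP : IsPolyhedron P) : (vertices P).Finite := by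
  obtain ⟨S, hS, rfl, -⟩ := hP
  exact hS.subset extremePoints_convexHull_subset

/-- The dimension of a subset of three-space, i.e. the dimension of its affine hull. -/
noncomputable def dim (F : Set E3) : ℕ :=
  Module.finrank ℝ (vectorSpan ℝ F)

/-- The faces (facets) of `P`: the intersections of `P` with supporting planes that are
two-dimensional. -/
def faces (P : Set E3) : Set (Set E3) :=
  {F | IsExposed ℝ P F ∧ dim F = 2}

/-- The number `V` of vertices. -/
noncomputable def vertexCount (P : Set E3) : ℕ∞ :=
  (vertices P).encard

/-- The number `F` of faces. -/
noncomputable def faceCount (P : Set E3) : ℕ∞ :=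
  (faces P).encard

/-- The plane through `q` perpendicular to the segment `[o, q]` (for `q ≠ o`). -/
def perpPlane (o q : E3) : Set E3 :=
  {x | inner ℝ (q - o) (x - q) = 0}

/-- `q` is an equilibrium point of `P` with respect to the interior point `o`: it lies on the
boundary of `P`, and the plane through `q` perpendicular to `[o, q]` supports `P` at `q`, i.e. `P`
lies in the closed half-space of this plane that contains `o`. -/
def IsEquilibrium (P : Set E3) (o q : E3) : Prop :=
  q ∈ frontier P ∧ ∀ x ∈ P, inner ℝ (q - o) (x - q) ≤ 0

/-- The equilibrium point `q` is nondegenerate: the intersection of `P` with the perpendicular plane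
at `q` is the vertex, edge or face of `P` that contains `q` in its relative interior. -/
def IsNondegenerateEquilibrium (P : Set E3) (o q : E3) : Prop :=
  IsEquilibrium P o q ∧ IsExposed ℝ P (perpPlane o q ∩ P) ∧
    q ∈ intrinsicInterior ℝ (perpPlane o q ∩ P)

/-- The equilibrium point `q` is unstable: it is nondegenerate, and the intersection of `P` with the
perpendicular plane at `q` has dimension zero. -/
def IsUnstableEquilibrium (P : Set E3) (o q : E3) : Prop :=
  IsNondegenerateEquilibrium P o q ∧ dim (perpPlane o q ∩ P) = 0

/-- The number `U` of unstable equilibrium points of `P` with respect to `o`. -/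
noncomputable def unstableCount (P : Set E3) (o : E3) : ℕ∞ :=
  {q | IsUnstableEquilibrium P o q}.encard

/-- The center of mass of `P` regarded as a 0-skeleton, i.e. with a unit mass at each vertex. -/
noncomputable def skeletonCenter (P : Set E3) : E3 :=
  ((vertices P).ncard : ℝ)⁻¹ • ∑ᶠ v ∈ vertices P, v

/-- The polyhedron `P` is a mono-unstable 0-skeleton: with a unit mass at each vertex, it has exactly
one unstable equilibrium point with respect to its center of mass. -/
def IsMonoUnstableSkeleton (P : Set E3) : Prop :=
  IsPolyhedron P ∧ unstableCount P (skeletonCenter P) = 1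

end MonoUnstable

/-! Lower bound. Let `o` be the center of mass. If a vertex `v` is not an unstable equilibrium, some
other vertex `w` satisfies `0 ≤ ⟪v - o, w - v⟫`; then `v - o` lies in the ball with diameter from
the origin to `w - o`, and `w - o` is strictly longer. In the mono-unstable case every vertex except
the farthest one, `r`, has such a parent, so the vectors from `o` to the vertices form a tree rooted
at `r - o`, and their sum is zero. With at most ten vertices this forces `r = o`
(`root_eq_zero_of_parents`), which is absurd. The reason is a family of inequalities `0 ≤ h‖v‖² +
⟪v, S⟫ + g‖S‖²` for the sum `S` of a forest of `m` vectors hanging from `v`, proved by recursion on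
`m` with numerical certificates (`Bound.tree`, `Bound.sum`). For nine vectors and `S = -v` they hold
with `h + g < 1`, hence `v = 0`. So there are at least eleven vertices.

Faces. For a generic linear functional every vertex is the highest or lowest point of some face
(`exists_face_extremal`), and the global top and bottom are so for at least three faces each. Each
face has at most one highest and one lowest vertex, so `V + 4 ≤ 2F` (`card_vertices_add_four_le`),
and `11 ≤ V` gives `8 ≤ F`.

Sharpness. An explicit simple polytope with twelve vertices and eight faces attains `V + 4 = 2F`;
its combinatorics and its unique unstable equilibrium are checked in integer arithmetic. -/

open scoped RealInnerProductSpace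

namespace MonoUnstable

/-! ### Forests of vectors in balls, and quadratic inequalities for their sums. -/

section Hang

variable {E : Type*} [NormedAddCommGroup E] [InnerProductSpace ℝ E]

/-- `Hang m v S`: the vector `S` is the sum of a forest of `m` vectors hanging from `v`, where each
vector lies in the closed ball having as diameter the segment from the origin to its parent. -/
inductive Hang : ℕ → E → E → Prop
  | zero (v : E) : Hang 0 v 0
  | node {m : ℕ} {v w S : E} : ⟪w, w⟫ ≤ ⟪v, w⟫ → Hang m w S → Hang (m + 1) v (w + S)
  | add {i j : ℕ} {v S T : E} : Hang i v S → Hang j v T → Hang (i + j) v (S + T)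

/-- The zero vector lies in every ball of the definition, so a forest can be padded with zeros. -/
theorem Hang.mono {m n : ℕ} {v S : E} (h : Hang m v S) (hmn : m ≤ n) : Hang n v S := by
  induction hmn with
  | refl => exact h
  | @step k _ ih =>
    have h0 : Hang 1 v (0 : E) := by
      simpa using Hang.node (v := v) (w := 0) (by simp) (Hang.zero (0 : E))
    simpa using ih.add h0

theorem Hang.eq_zero {m : ℕ} {v S : E} (h : Hang m v S) (hm : m = 0) : S = 0 := by
  induction h with
  | zero v => rfl
  | node _ _ _ => omega
  | add _ _ ih₁ ih₂ => rw [ih₁ (by omega), ih₂ (by omega), add_zero]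

/-- A forest is a single tree or splits into two smaller forests. -/
theorem Hang.cases_split {m : ℕ} {v S : E} (h : Hang m v S) (hm : 1 ≤ m) :
    (∃ w T, ⟪w, w⟫ ≤ ⟪v, w⟫ ∧ Hang (m - 1) w T ∧ S = w + T) ∨
      ∃ i j T U, 1 ≤ i ∧ i ≤ j ∧ i + j = m ∧ Hang i v T ∧ Hang j v U ∧ S = T + U := by
  induction h with
  | zero v => omega
  | @node m v w S hw h _ => exact .inl ⟨w, S, hw, by simpa using h, rfl⟩
  | @add i j v S T hi hj ih₁ ih₂ =>
    rcases Nat.eq_zero_or_pos i with rfl | hi'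
    · simpa [hi.eq_zero rfl] using ih₂ (by omega)
    rcases Nat.eq_zero_or_pos j with rfl | hj'
    · simpa [hj.eq_zero rfl] using ih₁ (by omega)
    rcases le_total i j with hij | hij
    · exact .inr ⟨i, j, S, T, hi', hij, rfl, hi, hj, rfl⟩
    · exact .inr ⟨j, i, T, S, hj', hij, add_comm _ _, hj, hi, add_comm _ _⟩

/-- A quadratic form in three vectors whose leading minors are positive, positive and nonnegative
is nonnegative. -/
theorem quadratic_nonneg {a b c d e f : ℝ} (ha : 0 < a) (hb : 0 < a * b - d ^ 2)
    (hc : 0 ≤ a * b * c + 2 * d * e * f - a * f ^ 2 - b * e ^ 2 - c * d ^ 2) (x y z : E) :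
    0 ≤ a * ⟪x, x⟫ + b * ⟪y, y⟫ + c * ⟪z, z⟫ + 2 * d * ⟪x, y⟫ + 2 * e * ⟪x, z⟫ +
      2 * f * ⟪y, z⟫ := by
  have h₁ : 0 ≤ ⟪a • x + d • y + e • z, a • x + d • y + e • z⟫ := real_inner_self_nonneg
  have h₂ : 0 ≤ ⟪(a * b - d ^ 2) • y + (a * f - d * e) • z,
    (a * b - d ^ 2) • y + (a * f - d * e) • z⟫ := real_inner_self_nonneg
  have h₃ : 0 ≤ ⟪z, z⟫ := real_inner_self_nonneg
  simp only [inner_add_left, inner_add_right, real_inner_smul_left, real_inner_smul_right,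
    real_inner_comm x y, real_inner_comm x z, real_inner_comm y z] at h₁ h₂
  -- Completing squares twice: `a * (a * b - d ^ 2)` times the form is `a * b - d ^ 2` times the
  -- square in `h₁`, plus the square in `h₂`, plus `a` times the determinant times `⟪z, z⟫`.
  refine nonneg_of_mul_nonneg_right (a := a * (a * b - d ^ 2)) ?_ (mul_pos ha hb)
  have h₄ := mul_nonneg hb.le h₁
  have h₅ := mul_nonneg ha.le (mul_nonneg hc h₃)
  linear_combination h₄ + h₂ + h₅

variable (E) in
/-- `Bound E m h g`: the sum `S` of every forest of `m` vectors hanging from `v` satisfies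
`0 ≤ h * ‖v‖ ^ 2 + ⟪v, S⟫ + g * ‖S‖ ^ 2`. -/
def Bound (m : ℕ) (h g : ℝ) : Prop :=
  ∀ v S : E, Hang m v S → 0 ≤ h * ⟪v, v⟫ + ⟪v, S⟫ + g * ⟪S, S⟫

variable (E) in
/-- The inequality of `Bound E (m + 1) h g`, for a forest that is a single tree. -/
def TreeBound (m : ℕ) (h g : ℝ) : Prop :=
  ∀ v w T : E, ⟪w, w⟫ ≤ ⟪v, w⟫ → Hang m w T →
    0 ≤ h * ⟪v, v⟫ + ⟪v, w + T⟫ + g * ⟪w + T, w + T⟫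

variable (E) in
/-- The inequality of `Bound E (i + j) h g`, for the union of two forests. -/
def SumBound (i j : ℕ) (h g : ℝ) : Prop :=
  ∀ v S T : E, Hang i v S → Hang j v T →
    0 ≤ h * ⟪v, v⟫ + ⟪v, S + T⟫ + g * ⟪S + T, S + T⟫

/-- Subtract from the desired expression `c` times the bound for the forest `T` below `w` and `l`
times the ball condition `0 ≤ ⟪v, w⟫ - ⟪w, w⟫`. What remains is a quadratic form in `w`, `w + T`,
`v`, and the last three conditions are its leading minors. The multipliers `c`, `l` are thus a
certificate, which the default tactics check numerically. -/
theorem Bound.tree {m : ℕ} {h' g' : ℝ} (H : Bound E m h' g') (c l : ℝ) {h g : ℝ}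
    (hc : 0 ≤ c := by norm_num)
    (hl : 0 ≤ l := by norm_num) (h₁ : 0 < l - c * (h' - 1 + g') := by norm_num)
    (h₂ : 0 < (l - c * (h' - 1 + g')) * (g - c * g') - (-(c * (1 / 2 - g'))) ^ 2 := by
      norm_num)
    (h₃ : 0 ≤ (l - c * (h' - 1 + g')) * (g - c * g') * h +
      2 * (-(c * (1 / 2 - g'))) * (-(l / 2)) * (1 / 2) -
      (l - c * (h' - 1 + g')) * (1 / 2) ^ 2 - (g - c * g') * (-(l / 2)) ^ 2 -
      h * (-(c * (1 / 2 - g'))) ^ 2 := by norm_num) :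
    TreeBound E m h g := by
  intro v w T hw hT
  have h₄ := quadratic_nonneg h₁ h₂ h₃ w (w + T) v
  have h₅ := mul_nonneg hc (H w T hT)
  have h₆ := mul_nonneg hl (sub_nonneg.2 hw)
  rw [real_inner_comm v w, real_inner_comm v (w + T)] at h₄
  simp only [inner_add_left, inner_add_right, real_inner_comm w T] at h₄ h₅ ⊢
  linear_combination h₄ + h₅ + h₆

/-- Same principle as `Bound.tree`: `c₁` and `c₂` weight the bounds for the two forests, and the
remainder is a nonnegative form in `S`, `T`, `v`. -/
theorem Bound.sum {i j : ℕ} {h₁ g₁ h₂ g₂ : ℝ} (H₁ : Bound E i h₁ g₁) (H₂ : Bound E j h₂ g₂)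
    (c₁ c₂ : ℝ) {h g : ℝ} (hc₁ : 0 ≤ c₁ := by norm_num)
    (hc₂ : 0 ≤ c₂ := by norm_num) (ha : 0 < g - c₁ * g₁ := by norm_num)
    (hb : 0 < (g - c₁ * g₁) * (g - c₂ * g₂) - g ^ 2 := by norm_num)
    (hc : 0 ≤ (g - c₁ * g₁) * (g - c₂ * g₂) * (h - c₁ * h₁ - c₂ * h₂) +
      2 * g * ((1 - c₁) / 2) * ((1 - c₂) / 2) -
      (g - c₁ * g₁) * ((1 - c₂) / 2) ^ 2 - (g - c₂ * g₂) * ((1 - c₁) / 2) ^ 2 -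
      (h - c₁ * h₁ - c₂ * h₂) * g ^ 2 := by norm_num) :
    SumBound E i j h g := by
  intro v S T hS hT
  have h₄ := quadratic_nonneg ha hb hc S T v
  have h₅ := mul_nonneg hc₁ (H₁ v S hS)
  have h₆ := mul_nonneg hc₂ (H₂ v T hT)
  rw [real_inner_comm v S, real_inner_comm v T] at h₄
  simp only [inner_add_left, inner_add_right, real_inner_comm S T] at h₄ h₅ h₆ ⊢
  linear_combination h₄ + h₅ + h₆

/-- The splits run over sizes `k + 1 ≤ m - k`, which is the condition `k < (m + 1) / 2`; the tree
case has `m` vectors besides its root `w`. -/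
theorem bound_succ {m : ℕ} {h g : ℝ} (h₁ : TreeBound E m h g)
    (h₂ : ∀ k < (m + 1) / 2, SumBound E (k + 1) (m - k) h g) :
    Bound E (m + 1) h g := by
  intro v S hS
  rcases hS.cases_split (by omega) with ⟨w, T, hw, hT, rfl⟩ | ⟨i, j, T, U, hi, hij, hm, hT, hU, rfl⟩
  · exact h₁ v w T hw (by simpa using hT)
  · obtain ⟨k, rfl⟩ := Nat.exists_eq_add_of_le' hi
    obtain rfl : j = m - k := by omega
    exact h₂ k (by omega) v T U hT hU

theorem bound_one : Bound E 1 0 (-1) := by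
  refine bound_succ (m := 0) ?_ fun k hk => by omega
  intro v w T hw hT
  rw [hT.eq_zero rfl]
  simp only [add_zero]
  linarith

end Hang

/-! ### Numerical bounds for forests of up to nine vectors. -/

section Bounds

variable {E : Type*} [NormedAddCommGroup E] [InnerProductSpace ℝ E]

/-- Several pairs `(h, g)` are kept for one size because they trade off: a smaller `g` costs a
larger `h`, and different later steps need different pairs. -/
theorem bounds_two :
    Bound E 2 (321 / 1000) (-29 / 50) ∧
      Bound E 2 (21 / 200) (-2 / 5) := by
  refine ⟨bound_succ ?_ fun k hk => ?_, bound_succ ?_ fun k hk => ?_⟩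
  · exact bound_one.tree (137 / 100) (261 / 100)
  · interval_cases k
    · exact bound_one.sum bound_one (33 / 25) (33 / 25)
  · exact bound_one.tree (279 / 100) (7 / 4)
  · interval_cases k
    · exact bound_one.sum bound_one 1 1

theorem bounds_three :
    Bound E 3 (37 / 50) (-41 / 100) ∧
      Bound E 3 (61 / 250) (-3 / 20) := by
  refine ⟨bound_succ ?_ fun k hk => ?_, bound_succ ?_ fun k hk => ?_⟩
  · exact bounds_two.1.tree (13 / 10) (411 / 100)
  · interval_cases k
    · exact bound_one.sum bounds_two.1 (29 / 20) (111 / 100)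
  · exact bounds_two.1.tree (51 / 25) (107 / 50)
  · interval_cases k
    · exact bound_one.sum bounds_two.2 (103 / 100) (19 / 20)

theorem bounds_four :
    Bound E 4 (139 / 100) (-33 / 100) ∧
      Bound E 4 (93 / 100) (-27 / 100) ∧
      Bound E 4 (429 / 1000) (-3 / 50) := by
  refine ⟨bound_succ ?_ fun k hk => ?_, bound_succ ?_ fun k hk => ?_, bound_succ ?_ fun k hk => ?_⟩
  · exact bounds_three.1.tree (5 / 4) (627 / 100)
  · interval_cases k
    · exact bound_one.sum bounds_three.1 (33 / 20) (28 / 25)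
    · exact bounds_two.1.sum bounds_two.1 (31 / 25) (31 / 25)
  · exact bounds_three.1.tree (33 / 25) (111 / 25)
  · interval_cases k
    · exact bound_one.sum bounds_three.1 (131 / 100) (89 / 100)
    · exact bounds_two.1.sum bounds_two.1 (49 / 50) (99 / 100)
  · exact bounds_three.1.tree (157 / 100) (49 / 20)
  · interval_cases k
    · exact bound_one.sum bounds_three.2 (103 / 100) (24 / 25)
    · exact bounds_two.2.sum bounds_two.2 (19 / 20) (19 / 20)

theorem bounds_five :
    Bound E 5 (2193 / 1000) (-7 / 25) ∧
      Bound E 5 (653 / 500) (-1 / 5) ∧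
      Bound E 5 (279 / 500) (3 / 100) := by
  refine ⟨bound_succ ?_ fun k hk => ?_, bound_succ ?_ fun k hk => ?_, bound_succ ?_ fun k hk => ?_⟩
  · exact bounds_four.1.tree (6 / 5) (433 / 50)
  · interval_cases k
    · exact bound_one.sum bounds_four.1 (46 / 25) (109 / 100)
    · exact bounds_two.1.sum bounds_three.1 (69 / 50) (61 / 50)
  · exact bounds_four.1.tree (119 / 100) (257 / 50)
  · interval_cases k
    · exact bound_one.sum bounds_four.2.1 (33 / 25) (23 / 25)
    · exact bounds_two.2.sum bounds_three.1 (59 / 50) (43 / 50)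
  · exact bounds_four.2.1.tree (31 / 20) (133 / 50)
  · interval_cases k
    · exact bound_one.sum bounds_four.2.2 (49 / 50) (93 / 100)
    · exact bounds_two.2.sum bounds_three.2 (91 / 100) (23 / 25)

theorem bounds_six :
    Bound E 6 (691 / 250) (-23 / 100) ∧
      Bound E 6 (213 / 125) (-3 / 20) ∧
      Bound E 6 (679 / 1000) (1 / 10) := by
  refine ⟨bound_succ ?_ fun k hk => ?_, bound_succ ?_ fun k hk => ?_, bound_succ ?_ fun k hk => ?_⟩
  · exact bounds_five.1.tree (23 / 20) (246 / 25)
  · interval_cases k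
    · exact bound_one.sum bounds_five.1 (91 / 50) (97 / 100)
    · exact bounds_two.1.sum bounds_four.1 (34 / 25) (53 / 50)
    · exact bounds_three.1.sum bounds_three.1 (6 / 5) (121 / 100)
  · exact bounds_five.1.tree (53 / 50) (563 / 100)
  · interval_cases k
    · exact bound_one.sum bounds_five.2.1 (67 / 50) (23 / 25)
    · exact bounds_two.2.sum bounds_four.2.1 (117 / 100) (89 / 100)
    · exact bounds_three.1.sum bounds_three.1 (91 / 100) (91 / 100)
  · exact bounds_five.2.1.tree (27 / 20) (64 / 25)
  · interval_cases k
    · exact bound_one.sum bounds_five.2.2 (89 / 100) (23 / 25)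
    · exact bounds_two.2.sum bounds_four.2.2 (83 / 100) (17 / 20)
    · exact bounds_three.2.sum bounds_three.2 (17 / 20) (17 / 20)

theorem bounds_seven :
    Bound E 7 (287 / 100) (-17 / 100) ∧
      Bound E 7 (973 / 500) (-1 / 10) ∧
      Bound E 7 (697 / 1000) (1 / 5) := by
  refine ⟨bound_succ ?_ fun k hk => ?_, bound_succ ?_ fun k hk => ?_, bound_succ ?_ fun k hk => ?_⟩
  · exact bounds_six.1.tree (28 / 25) (937 / 100)
  · interval_cases k
    · exact bound_one.sum bounds_six.1 (41 / 25) (22 / 25)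
    · exact bounds_two.1.sum bounds_five.1 (61 / 50) (87 / 100)
    · exact bounds_three.1.sum bounds_four.2.1 (26 / 25) (11 / 10)
  · exact bounds_six.1.tree 1 (141 / 25)
  · interval_cases k
    · exact bound_one.sum bounds_six.2.1 (129 / 100) (9 / 10)
    · exact bounds_two.2.sum bounds_five.2.1 (23 / 20) (43 / 50)
    · exact bounds_three.2.sum bounds_four.1 (59 / 50) (37 / 50)
  · exact bounds_six.2.1.tree (53 / 50) (48 / 25)
  · interval_cases k
    · exact bound_one.sum bounds_six.2.2 (71 / 100) (83 / 100)
    · exact bounds_two.2.sum bounds_five.2.2 (17 / 25) (19 / 25)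
    · exact bounds_three.2.sum bounds_four.2.2 (69 / 100) (7 / 10)

theorem bounds_eight :
    Bound E 8 (77 / 40) (-1 / 25) ∧
      Bound E 8 (13 / 20) (31 / 100) := by
  refine ⟨bound_succ ?_ fun k hk => ?_, bound_succ ?_ fun k hk => ?_⟩
  · exact bounds_seven.1.tree 1 (129 / 25)
  · interval_cases k
    · exact bound_one.sum bounds_seven.2.1 (113 / 100) (17 / 20)
    · exact bounds_two.2.sum bounds_six.2.1 (26 / 25) (79 / 100)
    · exact bounds_three.2.sum bounds_five.2.1 (103 / 100) (77 / 100)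
    · exact bounds_four.2.1.sum bounds_four.2.2 (39 / 50) (26 / 25)
  · exact bounds_seven.2.1.tree (3 / 4) (117 / 100)
  · interval_cases k
    · exact bound_one.sum bounds_seven.2.2 (12 / 25) (18 / 25)
    · exact bounds_two.2.sum bounds_six.2.2 (9 / 20) (57 / 100)
    · exact bounds_three.2.sum bounds_five.2.2 (47 / 100) (13 / 25)
    · exact bounds_four.2.2.sum bounds_four.2.2 (23 / 50) (23 / 50)

/-- A forest of nine vectors hanging from `v ≠ 0` does not have the sum `-v`. -/
theorem Hang.eq_zero_of_nine {v : E} (h : Hang 9 v (-v)) : v = 0 := by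
  -- The expression equals `(h + g - 1) * ⟪v, v⟫`. Only `h + g < 1` matters, so each shape of the
  -- forest below may use its own pair.
  have key : ∀ {h g : ℝ}, h + g < 1 → 0 ≤ h * ⟪v, v⟫ + ⟪v, -v⟫ + g * ⟪-v, -v⟫ → v = 0 := by
    intro h g hg H
    rw [inner_neg_neg, inner_neg_right] at H
    have h₀ : 0 ≤ ⟪v, v⟫ := real_inner_self_nonneg
    refine inner_self_eq_zero (𝕜 := ℝ).1 (le_antisymm ?_ h₀)
    nlinarith
  rcases h.cases_split (by norm_num) with ⟨w, T, hw, hT, hv⟩ | ⟨i, j, T, U, hi, hij, hm, hT, hU, hv⟩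
  · have H : TreeBound E 8 (67 / 125) (9 / 20) := bounds_eight.1.tree (43 / 100) (1 / 2)
    exact key (by norm_num) (hv ▸ H v w T hw hT)
  · have hi' : i ≤ 4 := by omega
    interval_cases i
    · obtain rfl : j = 8 := by omega
      have H : SumBound E 1 8 (67 / 125) (9 / 20) := bound_one.sum bounds_eight.2 (19 / 100) (43 / 100)
      exact key (by norm_num) (hv ▸ H v T U hT hU)
    · obtain rfl : j = 7 := by omega
      have H : SumBound E 2 7 (543 / 1000) (9 / 20) := bounds_two.2.sum bounds_seven.2.2 (7 / 50) (23 / 100)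
      exact key (by norm_num) (hv ▸ H v T U hT hU)
    · obtain rfl : j = 6 := by omega
      have H : SumBound E 3 6 (641 / 1000) (7 / 20) := bounds_three.2.sum bounds_six.2.2 (31 / 100) (39 / 100)
      exact key (by norm_num) (hv ▸ H v T U hT hU)
    · obtain rfl : j = 5 := by omega
      have H : SumBound E 4 5 (89 / 100) (1 / 10) := bounds_four.2.2.sum bounds_five.2.2 (19 / 25) (83 / 100)
      exact key (by norm_num) (hv ▸ H v T U hT hU)

end Bounds

/-! ### From parent relations to hanging forests. -/

section Trees

variable {E : Type*} [NormedAddCommGroup E] [InnerProductSpace ℝ E]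

/-- Forests hanging from the elements of a tree of vectors can be collected at its root. -/
theorem exists_hang_of_parents (n : ℕ) : ∀ (A : Finset E) (r : E) (k : E → ℕ) (S : E → E),
    A.card = n + 1 → r ∈ A →
    (∀ v ∈ A, v ≠ r → ∃ w ∈ A, ⟪v, v⟫ ≤ ⟪w, v⟫ ∧ ‖v‖ < ‖w‖) →
    (∀ v ∈ A, Hang (k v) v (S v)) →
    ∃ m T, Hang m r T ∧ m + 1 = ∑ v ∈ A, (k v + 1) ∧ r + T = ∑ v ∈ A, (v + S v) := by
  classical
  induction n with
  | zero =>
    intro A r k S hA hr _ hk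
    obtain ⟨a, rfl⟩ := Finset.card_eq_one.1 hA
    obtain rfl := Finset.mem_singleton.1 hr
    exact ⟨k r, S r, hk r hr, by simp, by simp⟩
  | succ n ih =>
    intro A r k S hA hr hp hk
    -- A shortest non-root vector `u` is nobody's parent, since parents are strictly longer. It can
    -- be removed once `u` and its forest are attached to its own parent `p`; the functions `k` and
    -- `S` record the sizes and sums collected so far.
    obtain ⟨u, hu, hmin⟩ := (A.erase r).exists_min_image (fun v => ‖v‖) (by
      rw [← Finset.card_pos, Finset.card_erase_of_mem hr]; omega)
    obtain ⟨hur, huA⟩ := Finset.mem_erase.1 hu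
    obtain ⟨p, hpA, hup, hlt⟩ := hp u huA hur
    have hpu : p ≠ u := fun h => by simp [h] at hlt
    obtain ⟨m, T, hT, hm, hsum⟩ := ih (A.erase u) r
      (fun v => k v + if v = p then k u + 1 else 0)
      (fun v => S v + if v = p then u + S u else 0)
      (by rw [Finset.card_erase_of_mem huA]; omega) (Finset.mem_erase.2 ⟨hur.symm, hr⟩)
      (by
        intro v hv hvr
        obtain ⟨-, hvA⟩ := Finset.mem_erase.1 hv
        obtain ⟨w, hw, h₁, h₂⟩ := hp v hvA hvr
        refine ⟨w, Finset.mem_erase.2 ⟨?_, hw⟩, h₁, h₂⟩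
        rintro rfl
        exact absurd (hmin v (Finset.mem_erase.2 ⟨hvr, hvA⟩)) (not_le.2 h₂))
      (by
        intro v hv
        obtain ⟨-, hvA⟩ := Finset.mem_erase.1 hv
        by_cases hvp : v = p
        · subst hvp
          simpa using (hk v hvA).add (.node hup (hk u huA))
        · simpa [hvp] using hk v hvA)
    have hpA' : p ∈ A.erase u := Finset.mem_erase.2 ⟨hpu, hpA⟩
    refine ⟨m, T, hT, ?_, ?_⟩
    · rw [hm, ← Finset.sum_erase_add _ _ huA]
      simp only [add_right_comm _ _ 1, Finset.sum_add_distrib, Finset.sum_ite_eq', hpA', if_true]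
    · rw [hsum, ← Finset.sum_erase_add _ _ huA]
      simp only [← add_assoc, Finset.sum_add_distrib, Finset.sum_ite_eq', hpA', if_true]

/-- At most ten vectors with sum zero, such that each of them except `r` lies in a ball having as
diameter the segment from the origin to a longer one of them: this is possible only for `r = 0`. -/
theorem root_eq_zero_of_parents {A : Finset E} {r : E} (hA : A.card ≤ 10) (hr : r ∈ A)
    (hp : ∀ v ∈ A, v ≠ r → ∃ w ∈ A, ⟪v, v⟫ ≤ ⟪w, v⟫ ∧ ‖v‖ < ‖w‖) (hsum : ∑ v ∈ A, v = 0) :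
    r = 0 := by
  obtain ⟨n, hn⟩ := Nat.exists_eq_add_of_le' (Finset.card_pos.2 ⟨r, hr⟩)
  obtain ⟨m, T, hT, hm, h⟩ := exists_hang_of_parents n A r (fun _ => 0) (fun _ => 0) hn hr hp
    fun v _ => .zero v
  simp only [zero_add, add_zero, Finset.sum_const, smul_eq_mul, mul_one, hsum] at hm h
  rw [eq_neg_of_add_eq_zero_right h] at hT
  exact (hT.mono (by omega)).eq_zero_of_nine

end Trees

/-! ### Unstable equilibria, and the lower bound of eleven vertices. -/

section Equilibria

variable {P : Set E3}

theorem IsPolyhedron.convex (hP : IsPolyhedron P) : Convex ℝ P := by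
  obtain ⟨S, -, rfl, -⟩ := hP
  exact convex_convexHull ℝ S

theorem IsPolyhedron.isCompact (hP : IsPolyhedron P) : IsCompact P := by
  obtain ⟨S, hS, rfl, -⟩ := hP
  exact hS.isCompact_convexHull (𝕜 := ℝ)

theorem IsPolyhedron.interior_nonempty (hP : IsPolyhedron P) : (interior P).Nonempty := by
  obtain ⟨S, hS, rfl, h⟩ := hP
  exact h

theorem IsPolyhedron.convexHull_vertices (hP : IsPolyhedron P) : convexHull ℝ (vertices P) = P :=
  (hP.finite_vertices.isCompact_convexHull (𝕜 := ℝ)).isClosed.closure_eq.symm.trans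
    (closure_convexHull_extremePoints hP.isCompact hP.convex)

theorem IsPolyhedron.nontrivial (hP : IsPolyhedron P) : P.Nontrivial := by
  by_contra h
  rw [Set.not_nontrivial_iff] at h
  obtain ⟨x, hx⟩ := hP.interior_nonempty
  have : P = {x} := h.eq_singleton_of_mem (interior_subset hx)
  rw [this, interior_singleton] at hx
  exact hx

theorem IsPolyhedron.vertices_nonempty (hP : IsPolyhedron P) : (vertices P).Nonempty :=
  hP.isCompact.extremePoints_nonempty hP.nontrivial.nonempty

theorem eq_of_dim_eq_zero {F : Set E3} (h : dim F = 0) {x y : E3} (hx : x ∈ F) (hy : y ∈ F) :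
    x = y := by
  have h₀ := vsub_mem_vectorSpan ℝ hx hy
  rw [Submodule.finrank_eq_zero.1 h, Submodule.mem_bot] at h₀
  exact vsub_eq_zero_iff_eq.1 h₀

/-- The unstable equilibria are the points at which the plane perpendicular to the segment from `o`
meets `P` in this point only and leaves `P` on the side of `o`. -/
theorem isUnstableEquilibrium_iff (hP : IsPolyhedron P) {o q : E3} :
    IsUnstableEquilibrium P o q ↔ q ∈ P ∧ ∀ x ∈ P, x ≠ q → ⟪q - o, x - q⟫ < 0 := by
  have hclosed := hP.isCompact.isClosed
  constructor
  · rintro ⟨⟨⟨hq, hle⟩, -, -⟩, hdim⟩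
    have hqP : q ∈ P := hclosed.frontier_subset hq
    refine ⟨hqP, fun x hx hxq => lt_of_le_of_ne (hle x hx) fun h0 => hxq ?_⟩
    exact eq_of_dim_eq_zero hdim ⟨h0, hx⟩ ⟨by simp [perpPlane], hqP⟩
  · rintro ⟨hqP, hlt⟩
    have hle : ∀ x ∈ P, ⟪q - o, x - q⟫ ≤ 0 := fun x hx => by
      rcases eq_or_ne x q with rfl | h
      · simp
      · exact (hlt x hx h).le
    have hface : perpPlane o q ∩ P = {q} := by
      ext x
      constructor
      · rintro ⟨h0, hx⟩
        by_contra hne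
        exact (hlt x hx hne).ne h0
      · rintro rfl
        exact ⟨by simp [perpPlane], hqP⟩
    have hqo : q - o ≠ 0 := by
      obtain ⟨x, hx, hxq⟩ := hP.nontrivial.exists_ne q
      intro h
      simpa [h] using hlt x hx hxq
    refine ⟨⟨⟨⟨subset_closure hqP, fun hint => ?_⟩, hle⟩, fun _ => ⟨innerSL ℝ (q - o), ?_⟩, ?_⟩, ?_⟩
    -- If `q` were interior, a small step from `q` away from `o` would stay in `P` but cross the
    -- supporting plane.
    · have hcont : Filter.Tendsto (fun t : ℝ => q + t • (q - o)) (nhds 0) (nhds q) := by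
        have : Continuous fun t : ℝ => q + t • (q - o) := by fun_prop
        simpa using this.tendsto 0
      have hev := (hcont.eventually (mem_interior_iff_mem_nhds.1 hint)).filter_mono
        (nhdsWithin_le_nhds (s := Set.Ioi 0))
      obtain ⟨t, ht, ht0⟩ := (hev.and self_mem_nhdsWithin).exists
      have h := hle _ ht
      rw [add_sub_cancel_left, inner_smul_right] at h
      have h1 : 0 < ⟪q - o, q - o⟫ := real_inner_self_pos.2 hqo
      exact absurd h (not_le.2 (mul_pos ht0 h1))
    · rw [hface]
      ext x
      simp only [Set.mem_singleton_iff, Set.mem_ofPred_eq, innerSL_apply_apply]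
      constructor
      · rintro rfl
        refine ⟨hqP, fun y hy => ?_⟩
        have := hle y hy
        rw [inner_sub_right] at this
        linarith
      · rintro ⟨hx, hmax⟩
        by_contra hne
        have h1 := hlt x hx hne
        have h2 := hmax q hqP
        rw [inner_sub_right] at h1
        linarith
    · rw [hface]
      simp
    · rw [hface, dim, vectorSpan_singleton, finrank_bot]

theorem IsPolyhedron.subset_of_vertices (hP : IsPolyhedron P) {C : Set E3} (hC : Convex ℝ C)
    (h : vertices P ⊆ C) : P ⊆ C := by
  rw [← hP.convexHull_vertices]
  exact convexHull_min h hC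

/-- An open half-space together with the single boundary point `q` is still convex, so it contains
`P` once it contains the vertices. -/
theorem inner_neg_of_vertices (hP : IsPolyhedron P) {a q : E3}
    (h : ∀ w ∈ vertices P, w ≠ q → ⟪a, w - q⟫ < 0) : ∀ x ∈ P, x ≠ q → ⟪a, x - q⟫ < 0 := by
  intro x hx hxq
  have hconv : Convex ℝ {x : E3 | x = q ∨ ⟪a, x - q⟫ < 0} := by
    intro x hx y hy s t ha hb hab
    have e : s • x + t • y - q = s • (x - q) + t • (y - q) := by
      rw [smul_sub, smul_sub, sub_add_sub_comm, ← add_smul, hab, one_smul]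
    simp only [Set.mem_ofPred_eq] at hx hy ⊢
    rw [← sub_eq_zero, e, inner_add_right, inner_smul_right, inner_smul_right]
    rcases hx with rfl | hx <;> rcases hy with rfl | hy
    · simp
    · rcases hb.eq_or_lt with rfl | hb
      · simp
      · right; simp only [sub_self, inner_zero_right, mul_zero, zero_add]
        exact mul_neg_of_pos_of_neg hb hy
    · rcases ha.eq_or_lt with rfl | ha
      · simp
      · right; simp only [sub_self, inner_zero_right, mul_zero, add_zero]
        exact mul_neg_of_pos_of_neg ha hx
    · right
      rcases ha.eq_or_lt with rfl | ha
      · rw [zero_add] at hab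
        simpa [hab] using hy
      · nlinarith [mul_neg_of_pos_of_neg ha hx, mul_nonpos_of_nonneg_of_nonpos hb hy.le]
  have hsub : vertices P ⊆ {x : E3 | x = q ∨ ⟪a, x - q⟫ < 0} := fun w hw => by
    by_cases hwq : w = q
    · exact .inl hwq
    · exact .inr (h w hw hwq)
  exact (hP.subset_of_vertices hconv hsub hx).resolve_left hxq

theorem isUnstableEquilibrium_of_vertices (hP : IsPolyhedron P) {o q : E3} (hq : q ∈ P)
    (h : ∀ w ∈ vertices P, w ≠ q → ⟪q - o, w - q⟫ < 0) : IsUnstableEquilibrium P o q :=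
  (isUnstableEquilibrium_iff hP).2 ⟨hq, inner_neg_of_vertices hP h⟩

/-- A mono-unstable 0-skeleton has at least eleven vertices. -/
theorem IsMonoUnstableSkeleton.eleven_le_vertexCount (hP : IsMonoUnstableSkeleton P) :
    11 ≤ vertexCount P := by
  classical
  obtain ⟨hP, hU⟩ := hP
  by_contra hlt
  have hfin := hP.finite_vertices
  set V := hfin.toFinset with hV
  have hmem : ∀ v, v ∈ V ↔ v ∈ vertices P := fun v => hfin.mem_toFinset
  have hcard : V.card ≤ 10 := by
    rw [not_le, vertexCount, hfin.encard_eq_coe_toFinset_card] at hlt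
    have : V.card < 11 := by exact_mod_cast hlt
    omega
  have hne : V.Nonempty := by
    obtain ⟨v, hv⟩ := hP.vertices_nonempty
    exact ⟨v, (hmem v).2 hv⟩
  set o := skeletonCenter P with ho
  have hsum : ∑ v ∈ V, (v - o) = 0 := by
    have h0 : (V.card : ℝ) ≠ 0 := by exact_mod_cast hne.card_pos.ne'
    rw [Finset.sum_sub_distrib, Finset.sum_const, ← Nat.cast_smul_eq_nsmul ℝ, ho, skeletonCenter,
      Set.ncard_eq_toFinset_card _ hfin, finsum_mem_eq_finite_toFinset_sum _ hfin, smul_smul,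
      mul_inv_cancel₀ h0, one_smul, sub_self]
  obtain ⟨r, hrV, hmax⟩ := V.exists_max_image (fun v => ‖v - o‖) hne
  have key : ∀ v w : E3, ⟪v - o, w - v⟫ = ⟪w - o, v - o⟫ - ⟪v - o, v - o⟫ := fun v w => by
    rw [real_inner_comm (v - o) (w - o), ← inner_sub_right, sub_sub_sub_cancel_right]
  -- Parents are strictly farther from `o`. This excludes cycles, and it makes the farthest vertex
  -- `r` an unstable equilibrium.
  have hpar : ∀ v w : E3, w ≠ v → 0 ≤ ⟪v - o, w - v⟫ → ‖v - o‖ < ‖w - o‖ := fun v w hwv h => by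
    have e : w - o = (v - o) + (w - v) := by abel
    have h1 : 0 < ‖w - v‖ := norm_pos_iff.2 (sub_ne_zero.2 hwv)
    have h2 := norm_add_sq_real (v - o) (w - v)
    rw [← e] at h2
    exact lt_of_pow_lt_pow_left₀ 2 (norm_nonneg _) (by nlinarith)
  have hunst : ∀ v ∈ V, (∀ w ∈ V, w ≠ v → ⟪v - o, w - v⟫ < 0) → IsUnstableEquilibrium P o v :=
    fun v hv h => isUnstableEquilibrium_of_vertices hP (extremePoints_subset ((hmem v).1 hv))
      fun w hw => h w ((hmem w).2 hw)
  have hr : IsUnstableEquilibrium P o r := hunst r hrV fun w hw hwr => by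
    by_contra h
    exact absurd (hmax w hw) (not_le.2 (hpar r w hwr (not_lt.1 h)))
  have huniq : ∀ v, IsUnstableEquilibrium P o v → v = r := by
    obtain ⟨a, ha⟩ := Set.encard_eq_one.1 hU
    intro v hv
    have h1 : v ∈ ({a} : Set E3) := ha ▸ hv
    have h2 : r ∈ ({a} : Set E3) := ha ▸ hr
    exact h1.trans h2.symm
  have hinj : Function.Injective fun v : E3 => v - o := sub_left_injective
  have hr0 : r - o = 0 := by
    refine root_eq_zero_of_parents (A := V.image fun v => v - o)
      ((Finset.card_image_le).trans hcard) (Finset.mem_image_of_mem _ hrV) ?_ ?_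
    · intro x hx hxr
      obtain ⟨v, hv, rfl⟩ := Finset.mem_image.1 hx
      have hvr : v ≠ r := fun h => hxr (by rw [h])
      have hnot : ¬ ∀ w ∈ V, w ≠ v → ⟪v - o, w - v⟫ < 0 := fun h => hvr (huniq v (hunst v hv h))
      push Not at hnot
      obtain ⟨w, hw, hwv, h⟩ := hnot
      refine ⟨w - o, Finset.mem_image_of_mem _ hw, ?_, hpar v w hwv h⟩
      rw [key] at h
      linarith
    · rw [Finset.sum_image hinj.injOn, hsum]
  -- As `r` is farthest from `o`, `r = o` collapses all vertices to `o`.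
  have hall : ∀ v ∈ vertices P, v = o := fun v hv => by
    have h := hmax v ((hmem v).2 hv)
    simp only [hr0, norm_zero] at h
    exact sub_eq_zero.1 (norm_le_zero_iff.1 h)
  exact hP.nontrivial.not_subset_singleton (hP.subset_of_vertices (convex_singleton o) hall)

end Equilibria

/-! ### Normal cones, and three faces through every vertex. -/

section Facets

variable {P F : Set E3}

theorem dim_empty : dim ∅ = 0 := by
  rw [dim, vectorSpan_empty, finrank_bot]

theorem finrank_E3 : Module.finrank ℝ E3 = 3 := by simp

/-- A functional exposing a face attains on `P` its maximum exactly at the points of the face. -/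
theorem exists_functional_of_isExposed (hF : IsExposed ℝ P F) {v : E3} (hv : v ∈ F) :
    ∃ l : StrongDual ℝ E3, (∀ x ∈ P, l x ≤ l v) ∧ ∀ x ∈ P, l x = l v ↔ x ∈ F := by
  obtain ⟨l, hl⟩ := hF ⟨v, hv⟩
  have hv' : v ∈ P ∧ ∀ y ∈ P, l y ≤ l v := by rw [hl] at hv; exact hv
  refine ⟨l, hv'.2, fun x hx => ⟨fun h => ?_, fun h => ?_⟩⟩
  · rw [hl]
    exact ⟨hx, fun y hy => h ▸ hv'.2 y hy⟩
  · rw [hl] at h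
    exact le_antisymm (hv'.2 x hx) (h.2 v hv'.1)

/-- The exposing functional is constant on the affine hull of `F`, so a point of `P` in that hull
also attains the maximum. -/
theorem mem_of_sub_mem_vectorSpan (hF : IsExposed ℝ P F) {v x : E3} (hv : v ∈ F) (hx : x ∈ P)
    (h : x - v ∈ vectorSpan ℝ F) : x ∈ F := by
  obtain ⟨l, -, hl⟩ := exists_functional_of_isExposed hF hv
  have hker : vectorSpan ℝ F ≤ LinearMap.ker l.toLinearMap := by
    rw [vectorSpan_eq_span_vsub_set_right ℝ hv, Submodule.span_le]
    rintro _ ⟨y, hy, rfl⟩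
    simp [(hl y (hF.subset hy)).2 hy]
  have := hker h
  simp only [LinearMap.mem_ker, ContinuousLinearMap.coe_coe, map_sub, sub_eq_zero] at this
  exact (hl x hx).1 this

/-- Two different faces meet in a set of dimension at most one. -/
theorem finrank_vectorSpan_inter_le_one {G : Set E3} (hF : F ∈ faces P) (hG : G ∈ faces P)
    (hFG : F ≠ G) : Module.finrank ℝ (vectorSpan ℝ (F ∩ G)) ≤ 1 := by
  by_contra h
  have hne : (F ∩ G).Nonempty := by
    rw [Set.nonempty_iff_ne_empty]
    intro h0
    rw [h0] at h
    have := dim_empty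
    rw [dim] at this
    omega
  obtain ⟨v, hvF, hvG⟩ := hne
  have hF' : vectorSpan ℝ (F ∩ G) = vectorSpan ℝ F :=
    Submodule.eq_of_le_of_finrank_le (vectorSpan_mono ℝ Set.inter_subset_left) (by
      have := hF.2; rw [dim] at this; omega)
  have hG' : vectorSpan ℝ (F ∩ G) = vectorSpan ℝ G :=
    Submodule.eq_of_le_of_finrank_le (vectorSpan_mono ℝ Set.inter_subset_right) (by
      have := hG.2; rw [dim] at this; omega)
  have hspan := hF'.symm.trans hG'
  refine hFG (Set.Subset.antisymm (fun x hx => ?_) fun x hx => ?_)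
  · exact mem_of_sub_mem_vectorSpan hG.1 hvG (hF.1.subset hx)
      (hspan ▸ vsub_mem_vectorSpan ℝ hx hvF)
  · exact mem_of_sub_mem_vectorSpan hF.1 hvF (hG.1.subset hx)
      (hspan ▸ vsub_mem_vectorSpan ℝ hx hvG)

theorem exists_ne_zero_orthogonal {M : Submodule ℝ E3} (hM : Module.finrank ℝ M < 3) :
    ∃ b : E3, b ≠ 0 ∧ ∀ x ∈ M, ⟪b, x⟫ = 0 := by
  have h := Submodule.finrank_add_finrank_orthogonal M
  rw [finrank_E3] at h
  have hne : Mᗮ ≠ ⊥ := fun h0 => by rw [h0, finrank_bot] at h; omega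
  obtain ⟨b, hb, hb0⟩ := Submodule.exists_mem_ne_zero_of_ne_bot hne
  exact ⟨b, hb0, fun x hx => by rw [real_inner_comm]; exact hb x hx⟩

theorem finrank_span_pair_lt (x y : E3) : Module.finrank ℝ (Submodule.span ℝ {x, y}) < 3 := by
  classical
  have h := finrank_span_finset_le_card (R := ℝ) ({x, y} : Finset E3)
  have h2 : ({x, y} : Finset E3).card ≤ 2 := Finset.card_le_two
  rw [Finset.coe_pair] at h
  exact (h.trans h2).trans_lt (by norm_num)

/-- A vector whose inner products with finitely many vectors are nonpositive may be moved a little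
in both directions along `b`, if `b` is orthogonal to those vectors where the product is zero. -/
theorem exists_pos_perturbation {W : Set E3} (hW : W.Finite) {a b : E3}
    (h : ∀ w ∈ W, ⟪a, w⟫ < 0 ∨ ⟪a, w⟫ = 0 ∧ ⟪b, w⟫ = 0) :
    ∃ t : ℝ, 0 < t ∧ ∀ w ∈ W, ⟪a + t • b, w⟫ ≤ 0 ∧ ⟪a - t • b, w⟫ ≤ 0 := by
  have hev : ∀ w ∈ W, ∀ᶠ t : ℝ in nhds 0, ⟪a + t • b, w⟫ ≤ 0 ∧ ⟪a - t • b, w⟫ ≤ 0 := by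
    intro w hw
    rcases h w hw with h | ⟨h₁, h₂⟩
    · have c₁ : Continuous fun t : ℝ => ⟪a + t • b, w⟫ := by fun_prop
      have c₂ : Continuous fun t : ℝ => ⟪a - t • b, w⟫ := by fun_prop
      have e₁ := c₁.tendsto 0 |>.eventually (gt_mem_nhds (by simpa using h))
      have e₂ := c₂.tendsto 0 |>.eventually (gt_mem_nhds (by simpa using h))
      filter_upwards [e₁, e₂] with t h₁ h₂
      exact ⟨h₁.le, h₂.le⟩
    · refine .of_forall fun t => ?_
      simp [inner_add_left, inner_sub_left, inner_smul_left, h₁, h₂]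
  have hall := ((Filter.eventually_all_finite hW).2 hev).filter_mono
    (nhdsWithin_le_nhds (s := Set.Ioi 0))
  obtain ⟨t, ht, ht0⟩ := (hall.and self_mem_nhdsWithin).exists
  exact ⟨t, ht0, ht⟩

/-- A slice of the cone of the normals of the planes supporting `P` at `v`. -/
def normalSlice (P : Set E3) (v c : E3) : Set E3 :=
  {a | (∀ x ∈ P, ⟪a, x - v⟫ ≤ 0) ∧ ⟪a, c - v⟫ = -1}

theorem convex_normalSlice (P : Set E3) (v c : E3) : Convex ℝ (normalSlice P v c) := by
  rintro a ⟨ha, ha'⟩ b ⟨hb, hb'⟩ s t hs ht hst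
  refine ⟨fun x hx => ?_, ?_⟩
  · rw [inner_add_left, real_inner_smul_left, real_inner_smul_left]
    nlinarith [mul_nonpos_of_nonneg_of_nonpos hs (ha x hx),
      mul_nonpos_of_nonneg_of_nonpos ht (hb x hx)]
  · rw [inner_add_left, real_inner_smul_left, real_inner_smul_left, ha', hb']
    linarith

/-- If `P` contains the ball of radius `r` about `c`, testing a normal `a` at `c + (r / ‖a‖) a`
gives `r‖a‖ ≤ 1`. -/
theorem isCompact_normalSlice {v c : E3} (hc : c ∈ interior P) :
    IsCompact (normalSlice P v c) := by
  obtain ⟨r, hr, hball⟩ := Metric.nhds_basis_closedBall.mem_iff.1 (mem_interior_iff_mem_nhds.1 hc)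
  refine Metric.isCompact_of_isClosed_isBounded ?_ ?_
  · have h : normalSlice P v c = (⋂ x ∈ P, {a | ⟪a, x - v⟫ ≤ 0}) ∩ {a | ⟪a, c - v⟫ = -1} := by
      ext a; simp [normalSlice]
    rw [h]
    refine IsClosed.inter (isClosed_biInter fun x _ => ?_) ?_
    · exact isClosed_le (by fun_prop) continuous_const
    · exact isClosed_eq (by fun_prop) continuous_const
  · refine (Metric.isBounded_closedBall (x := (0 : E3)) (r := r⁻¹)).subset ?_
    rintro a ⟨ha, ha'⟩
    rw [mem_closedBall_zero_iff]
    rcases eq_or_ne a 0 with rfl | h0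
    · simp [hr.le]
    have hn : 0 < ‖a‖ := norm_pos_iff.2 h0
    have hx : c + (r * ‖a‖⁻¹) • a ∈ P := by
      refine hball ?_
      rw [mem_closedBall_iff_norm, add_sub_cancel_left, norm_smul, Real.norm_of_nonneg (by positivity),
        mul_assoc, inv_mul_cancel₀ hn.ne', mul_one]
    have h := ha _ hx
    rw [add_sub_right_comm, inner_add_right, ha', real_inner_smul_right, real_inner_self_eq_norm_sq] at h
    have e : r * ‖a‖⁻¹ * ‖a‖ ^ 2 = r * ‖a‖ := by field_simp
    rw [e] at h
    rw [← one_div, le_div_iff₀ hr]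
    linarith

theorem inner_nonpos_of_vertices (hP : IsPolyhedron P) {a v : E3}
    (h : ∀ w ∈ vertices P, ⟪a, w - v⟫ ≤ 0) : ∀ x ∈ P, ⟪a, x - v⟫ ≤ 0 := by
  intro x hx
  have hconv : Convex ℝ {x : E3 | ⟪a, x⟫ ≤ ⟪a, v⟫} :=
    convex_halfSpace_le (innerSL ℝ a).toLinearMap.isLinear _
  have hin := hP.subset_of_vertices hconv (fun w hw => by
    have := h w hw
    rw [inner_sub_right] at this
    exact sub_nonpos.1 this) hx
  rw [inner_sub_right]
  exact sub_nonpos.2 hin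

/-- The extreme points of the slice of the normal cone at `v` are normals of faces. -/
theorem face_of_extreme_normal (hP : IsPolyhedron P) {v c a : E3} (hv : v ∈ P)
    (ha : a ∈ (normalSlice P v c).extremePoints ℝ) :
    {x ∈ P | ⟪a, x - v⟫ = 0} ∈ faces P := by
  obtain ⟨⟨hle, hc⟩, hext⟩ := mem_extremePoints.1 ha
  set F : Set E3 := {x ∈ P | ⟪a, x - v⟫ = 0} with hF
  have ha0 : a ≠ 0 := by rintro rfl; simp at hc
  have hvF : v ∈ F := ⟨hv, by simp⟩
  refine ⟨fun _ => ⟨innerSL ℝ a, ?_⟩, le_antisymm ?_ ?_⟩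
  · ext x
    simp only [hF, Set.mem_ofPred_eq, innerSL_apply_apply]
    refine and_congr_right fun hx => ⟨fun h y hy => ?_, fun h => ?_⟩
    · have := hle y hy
      rw [inner_sub_right] at this h
      linarith
    · have h1 := hle x hx
      have h2 := h v hv
      rw [inner_sub_right] at h1 ⊢
      linarith
  · have hsub : vectorSpan ℝ F ≤ (Submodule.span ℝ {a})ᗮ := by
      rw [vectorSpan_eq_span_vsub_set_right ℝ hvF, Submodule.span_le]
      rintro _ ⟨y, hy, rfl⟩
      exact Submodule.mem_orthogonal_singleton_iff_inner_right.2 hy.2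
    have h1 := Submodule.finrank_mono hsub
    have h2 := Submodule.finrank_add_finrank_orthogonal (Submodule.span ℝ {a})
    rw [finrank_span_singleton ha0, finrank_E3] at h2
    rw [dim]
    omega
  -- If the face had dimension at most one, some `b ≠ 0` would be orthogonal both to it and to `c -
  -- v`. Then `a ± t • b` lie in the slice for small `t`, and `a` is their midpoint.
  · by_contra hlt
    rw [dim, not_le] at hlt
    have hlt3 : Module.finrank ℝ ↥(vectorSpan ℝ F ⊔ Submodule.span ℝ {c - v}) < 3 := by
      have h1 := Submodule.finrank_add_le_finrank_add_finrank (vectorSpan ℝ F)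
        (Submodule.span ℝ {c - v})
      have h2 : Module.finrank ℝ (Submodule.span ℝ {c - v}) ≤ 1 := by
        have h := finrank_span_finset_le_card (R := ℝ) ({c - v} : Finset E3)
        rwa [Finset.coe_singleton] at h
      omega
    obtain ⟨b, hb0, hb⟩ := exists_ne_zero_orthogonal hlt3
    obtain ⟨t, ht, hpert⟩ := exists_pos_perturbation (a := a) (b := b)
      (hP.finite_vertices.image fun w => w - v) (by
        rintro _ ⟨w, hw, rfl⟩
        have hwP := extremePoints_subset hw
        rcases (hle w hwP).lt_or_eq with h | h
        · exact .inl h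
        · exact .inr ⟨h, hb _ (Submodule.mem_sup_left (vsub_mem_vectorSpan ℝ ⟨hwP, h⟩ hvF))⟩)
    have hbc : ⟪b, c - v⟫ = 0 :=
      hb _ (Submodule.mem_sup_right (Submodule.mem_span_singleton_self _))
    have h₁ : a + t • b ∈ normalSlice P v c :=
      ⟨inner_nonpos_of_vertices hP fun w hw => (hpert _ ⟨w, hw, rfl⟩).1, by
        rw [inner_add_left, real_inner_smul_left, hbc, hc]; simp⟩
    have h₂ : a - t • b ∈ normalSlice P v c :=
      ⟨inner_nonpos_of_vertices hP fun w hw => (hpert _ ⟨w, hw, rfl⟩).2, by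
        rw [inner_sub_left, real_inner_smul_left, hbc, hc]; simp⟩
    have h₃ := hext _ h₁ _ h₂ ⟨1 / 2, 1 / 2, by norm_num, by norm_num, by norm_num, by module⟩
    have h₄ : t • b = 0 := by simpa using h₃.1
    exact (smul_ne_zero ht.ne' hb0) h₄

/-- The normals of a two-dimensional face form a line, on which the normalization at `c - v` selects
one point. -/
theorem normal_injective {v c a b : E3} (ha : ⟪a, c - v⟫ = -1) (hb : ⟪b, c - v⟫ = -1) (hv : v ∈ P)
    (hF : {x ∈ P | ⟪a, x - v⟫ = 0} ∈ faces P)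
    (hab : {x ∈ P | ⟪a, x - v⟫ = 0} = {x ∈ P | ⟪b, x - v⟫ = 0}) : a = b := by
  have hspan : ∀ e : E3, {x ∈ P | ⟪a, x - v⟫ = 0} = {x ∈ P | ⟪e, x - v⟫ = 0} →
      e ∈ (vectorSpan ℝ {x ∈ P | ⟪a, x - v⟫ = 0})ᗮ := by
    intro e he
    have hle : vectorSpan ℝ {x ∈ P | ⟪a, x - v⟫ = 0} ≤ (Submodule.span ℝ {e})ᗮ := by
      have hve : v ∈ {x ∈ P | ⟪e, x - v⟫ = 0} := ⟨hv, by simp⟩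
      rw [he, vectorSpan_eq_span_vsub_set_right ℝ hve, Submodule.span_le]
      rintro _ ⟨y, hy, rfl⟩
      exact Submodule.mem_orthogonal_singleton_iff_inner_right.2 hy.2
    intro x hx
    exact Submodule.mem_orthogonal_singleton_iff_inner_left.1 (hle hx)
  have h := Submodule.finrank_add_finrank_orthogonal (vectorSpan ℝ {x ∈ P | ⟪a, x - v⟫ = 0})
  have h2 := hF.2
  rw [dim] at h2
  rw [finrank_E3, h2] at h
  have h1 : Module.finrank ℝ ↥(vectorSpan ℝ {x ∈ P | ⟪a, x - v⟫ = 0})ᗮ = 1 := by omega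
  have ha0 : (⟨a, hspan a rfl⟩ : ↥(vectorSpan ℝ {x ∈ P | ⟪a, x - v⟫ = 0})ᗮ) ≠ 0 := by
    intro h0
    have : a = 0 := congrArg Subtype.val h0
    rw [this] at ha
    simp at ha
  obtain ⟨s, hs⟩ := (finrank_eq_one_iff_of_nonzero' _ ha0).1 h1 ⟨b, hspan b hab⟩
  have hs' : s • a = b := congrArg Subtype.val hs
  rw [← hs', real_inner_smul_left, ha] at hb
  have : s = 1 := by linarith
  rw [← hs', this, one_smul]

/-- Every vertex of a polyhedron lies on at least three faces. -/
theorem exists_three_faces (hP : IsPolyhedron P) {v : E3} (hv : v ∈ vertices P) :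
    ∃ F : Fin 3 → Set E3, Function.Injective F ∧ ∀ i, F i ∈ faces P ∧ v ∈ F i := by
  have hvP : v ∈ P := extremePoints_subset hv
  obtain ⟨c, hc, hcv⟩ := (dense_compl_singleton v).inter_open_nonempty _ isOpen_interior
    hP.interior_nonempty
  have hcP := interior_subset hc
  have hK := isCompact_normalSlice (v := v) hc
  -- Separating `v` from the hull of the other vertices yields a normal strict away from `v`, hence
  -- one that can be perturbed.
  obtain ⟨a₀, ha₀c, ha₀⟩ : ∃ a : E3, ⟪a, c - v⟫ = -1 ∧ ∀ x ∈ P, x ≠ v → ⟪a, x - v⟫ < 0 := by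
    have hnot : v ∉ convexHull ℝ (vertices P \ {v}) := fun h =>
      (hP.convex.mem_extremePoints_iff_mem_sdiff_convexHull_sdiff.1 hv).2
        (convexHull_mono (Set.sdiff_subset_sdiff_left extremePoints_subset) h)
    obtain ⟨l, u, h₁, h₂⟩ := geometric_hahn_banach_closed_point (convex_convexHull ℝ _)
      ((hP.finite_vertices.subset Set.sdiff_subset).isCompact_convexHull (𝕜 := ℝ)).isClosed hnot
    set a := (InnerProductSpace.toDual ℝ E3).symm l with ha
    have hneg := inner_neg_of_vertices hP (a := a) (q := v) fun w hw hwv => by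
      have := h₁ w (subset_convexHull ℝ _ ⟨hw, hwv⟩)
      rw [ha, InnerProductSpace.toDual_symm_apply, map_sub]
      linarith
    have hcneg := hneg c hcP hcv
    refine ⟨(-⟪a, c - v⟫)⁻¹ • a, ?_, fun x hx hxv => ?_⟩
    · rw [real_inner_smul_left, inv_neg, neg_mul, inv_mul_cancel₀ hcneg.ne]
    · rw [real_inner_smul_left]
      exact mul_neg_of_pos_of_neg (inv_pos.2 (neg_pos.2 hcneg)) (hneg x hx hxv)
  -- With no extreme points besides `a₁` and `a₂`, the Krein–Milman theorem makes every `b`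
  -- orthogonal to `a₂ - a₁` constant on the slice. If `b` is also orthogonal to `c - v`, then `a₀ +
  -- t • b` stays in the slice, a contradiction.
  have key : ∀ a₁ a₂ : E3, ∃ a ∈ (normalSlice P v c).extremePoints ℝ, a ≠ a₁ ∧ a ≠ a₂ := by
    intro a₁ a₂
    by_contra! hcon
    obtain ⟨b, hb0, hb⟩ := exists_ne_zero_orthogonal (finrank_span_pair_lt (c - v) (a₂ - a₁))
    have hb₁ : ⟪b, c - v⟫ = 0 := hb _ (Submodule.subset_span (by simp))
    have hb₂ : ⟪b, a₂ - a₁⟫ = 0 := hb _ (Submodule.subset_span (by simp))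
    have hconst : ∀ a ∈ normalSlice P v c, ⟪b, a⟫ = ⟪b, a₁⟫ := by
      have hclosed : IsClosed {a : E3 | ⟪b, a⟫ = ⟪b, a₁⟫} :=
        isClosed_eq (by fun_prop) continuous_const
      have hconv : Convex ℝ {a : E3 | ⟪b, a⟫ = ⟪b, a₁⟫} :=
        convex_hyperplane (innerSL ℝ b).toLinearMap.isLinear _
      have hsub : (normalSlice P v c).extremePoints ℝ ⊆ {a : E3 | ⟪b, a⟫ = ⟪b, a₁⟫} := by
        intro a ha
        by_cases h : a = a₁
        · simp [h]
        · rw [hcon a ha h, Set.mem_ofPred_eq, ← sub_eq_zero, ← inner_sub_right, hb₂]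
      intro a ha
      rw [← closure_convexHull_extremePoints hK (convex_normalSlice P v c)] at ha
      exact closure_minimal (convexHull_min hsub hconv) hclosed ha
    obtain ⟨t, ht, hpert⟩ := exists_pos_perturbation (a := a₀) (b := b)
      (hP.finite_vertices.image fun w => w - v) (by
        rintro _ ⟨w, hw, rfl⟩
        by_cases hwv : w = v
        · exact .inr (by simp [hwv])
        · exact .inl (ha₀ w (extremePoints_subset hw) hwv))
    have h₀ : a₀ ∈ normalSlice P v c := ⟨fun x hx => by
      by_cases hxv : x = v
      · simp [hxv]
      · exact (ha₀ x hx hxv).le, ha₀c⟩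
    have h₁ : a₀ + t • b ∈ normalSlice P v c := by
      exact ⟨inner_nonpos_of_vertices hP fun w hw => (hpert _ ⟨w, hw, rfl⟩).1,
        by rw [inner_add_left, real_inner_smul_left, hb₁, ha₀c]; simp⟩
    have h₂ := hconst _ h₁
    rw [inner_add_right, hconst _ h₀, real_inner_smul_right] at h₂
    have h₃ : t * ⟪b, b⟫ = 0 := by linarith
    exact (mul_pos ht (real_inner_self_pos.2 hb0)).ne' h₃
  obtain ⟨a₁, h₁, -, -⟩ := key 0 0
  obtain ⟨a₂, h₂, h₂₁, -⟩ := key a₁ a₁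
  obtain ⟨a₃, h₃, h₃₁, h₃₂⟩ := key a₁ a₂
  have hinj : ∀ a ∈ (normalSlice P v c).extremePoints ℝ,
      ∀ b ∈ (normalSlice P v c).extremePoints ℝ,
      {x ∈ P | ⟪a, x - v⟫ = 0} = {x ∈ P | ⟪b, x - v⟫ = 0} → a = b := fun a ha b hb =>
    normal_injective (extremePoints_subset ha).2 (extremePoints_subset hb).2 hvP
      (face_of_extreme_normal hP hvP ha)
  refine ⟨fun i => {x ∈ P | ⟪![a₁, a₂, a₃] i, x - v⟫ = 0}, ?_, fun i => ⟨?_, hvP, by simp⟩⟩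
  · have hmem : ∀ i, ![a₁, a₂, a₃] i ∈ (normalSlice P v c).extremePoints ℝ := by
      intro i; fin_cases i <;> assumption
    intro i j hij
    have h := hinj _ (hmem i) _ (hmem j) hij
    fin_cases i <;> fin_cases j <;>
      first
      | rfl
      | exact absurd h h₂₁
      | exact absurd h h₃₁
      | exact absurd h h₃₂
      | exact absurd h.symm h₂₁
      | exact absurd h.symm h₃₁
      | exact absurd h.symm h₃₂
  · refine face_of_extreme_normal (c := c) hP hvP ?_
    fin_cases i <;> assumption

end Facets

/-! ### Sweeping by a generic functional: the inequality between vertices and faces. -/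

section Counting

variable {P : Set E3}

/-- A functional that separates the vertices of `P` and, on the intersection of any two faces of
`P`, all points. -/
theorem exists_generic_functional (hP : IsPolyhedron P) (hfin : (faces P).Finite) :
    ∃ f : Module.Dual ℝ E3, Set.InjOn f (vertices P) ∧
      ∀ F ∈ faces P, ∀ G ∈ faces P, F ≠ G → Set.InjOn f (F ∩ G) := by
  classical
  -- A filler direction for pairs of faces whose intersection does not determine one.
  obtain ⟨e, he⟩ := exists_ne (0 : E3)
  have hdir : ∀ F G : Set E3, ∃ d : E3, d ≠ 0 ∧
      (F ∈ faces P → G ∈ faces P → F ≠ G → vectorSpan ℝ (F ∩ G) ≤ Submodule.span ℝ {d}) := by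
    intro F G
    by_cases h : F ∈ faces P ∧ G ∈ faces P ∧ F ≠ G
    · obtain ⟨d, hd⟩ := finrank_le_one_iff.1 (finrank_vectorSpan_inter_le_one h.1 h.2.1 h.2.2)
      by_cases hd0 : (d : E3) = 0
      · refine ⟨e, he, fun _ _ _ x hx => ?_⟩
        obtain ⟨c, hc⟩ := hd ⟨x, hx⟩
        have : c • (d : E3) = x := congrArg Subtype.val hc
        rw [← this, hd0, smul_zero]
        exact Submodule.zero_mem _
      · refine ⟨d, hd0, fun _ _ _ x hx => ?_⟩
        obtain ⟨c, hc⟩ := hd ⟨x, hx⟩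
        exact Submodule.mem_span_singleton.2 ⟨c, congrArg Subtype.val hc⟩
    · exact ⟨e, he, fun h₁ h₂ h₃ => absurd ⟨h₁, h₂, h₃⟩ h⟩
  choose d hd0 hd using hdir
  set D : Set E3 := ((fun p : E3 × E3 => p.1 - p.2) '' (vertices P ×ˢ vertices P) ∪
    (fun p : Set E3 × Set E3 => d p.1 p.2) '' (faces P ×ˢ faces P)) \ {0} with hD
  have hDfin : D.Finite := (((hP.finite_vertices.prod hP.finite_vertices).image _).union
    ((hfin.prod hfin).image _)).sdiff
  have : Finite D := hDfin
  obtain ⟨f, hf⟩ := Module.exists_dual_forall_apply_ne_zero (K := ℝ) (fun x : D => (x : E3))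
    fun x => x.2.2
  refine ⟨f, fun v hv w hw hvw => ?_, fun F hF G hG hFG x hx y hy hxy => ?_⟩
  · by_contra hne
    refine hf ⟨v - w, .inl ⟨(v, w), ⟨hv, hw⟩, rfl⟩, sub_ne_zero.2 hne⟩ ?_
    simp [hvw]
  · have hfd : f (d F G) ≠ 0 := hf ⟨d F G, .inr ⟨(F, G), ⟨hF, hG⟩, rfl⟩, hd0 F G⟩
    obtain ⟨c, hc⟩ := Submodule.mem_span_singleton.1
      (hd F G hF hG hFG (vsub_mem_vectorSpan ℝ hx hy))
    have h := congrArg f hc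
    rw [vsub_eq_sub, map_sub, hxy, sub_self, map_smul, smul_eq_mul] at h
    rw [(mul_eq_zero.1 h).resolve_right hfd, zero_smul, vsub_eq_sub] at hc
    exact sub_eq_zero.1 hc.symm

/-- Join a point below `v` to a point above it; the segment crosses the level of `v`, and not at
`v`, which is extreme. -/
theorem exists_apply_eq_of_not_extremal {F : Set E3} (hF : Convex ℝ F) {v : E3}
    (hv : v ∈ F.extremePoints ℝ) (f : Module.Dual ℝ E3)
    (h : ¬ ((∀ x ∈ F, f x ≤ f v) ∨ ∀ x ∈ F, f v ≤ f x)) : ∃ x ∈ F, x ≠ v ∧ f x = f v := by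
  push Not at h
  obtain ⟨⟨z, hz, hvz⟩, y, hy, hyv⟩ := h
  have hpos : 0 < f z - f y := by linarith
  refine ⟨((f z - f v) / (f z - f y)) • y + ((f v - f y) / (f z - f y)) • z, ?_, fun heq => ?_, ?_⟩
  · exact hF hy hz (div_nonneg (by linarith) hpos.le) (div_nonneg (by linarith) hpos.le)
      (by field_simp; ring)
  · have h := (mem_extremePoints.1 hv).2 y hy z hz ⟨_, _, div_pos (by linarith) hpos,
      div_pos (by linarith) hpos, by field_simp; ring, heq⟩
    rw [h.1] at hyv
    exact lt_irrefl _ hyv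
  · simp only [map_add, map_smul, smul_eq_mul]
    field_simp
    ring

/-- For a generic functional, every vertex is the highest or the lowest point of a face. -/
theorem exists_face_extremal (hP : IsPolyhedron P) {f : Module.Dual ℝ E3} (hf0 : f ≠ 0)
    (hf : ∀ F ∈ faces P, ∀ G ∈ faces P, F ≠ G → Set.InjOn f (F ∩ G)) {v : E3}
    (hv : v ∈ vertices P) :
    ∃ F ∈ faces P, v ∈ F ∧ ((∀ x ∈ F, f x ≤ f v) ∨ ∀ x ∈ F, f v ≤ f x) := by
  by_contra! hcon
  obtain ⟨F, hinj, hF⟩ := exists_three_faces hP hv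
  have hx : ∀ i, ∃ x ∈ F i, x ≠ v ∧ f x = f v := fun i => by
    have hsub : F i ⊆ P := (hF i).1.1.subset
    refine exists_apply_eq_of_not_extremal ((hF i).1.1.convex hP.convex) ?_ f ?_
    · exact inter_extremePoints_subset_extremePoints_of_subset hsub ⟨(hF i).2, hv⟩
    · have := hcon (F i) (hF i).1 (hF i).2
      push Not
      exact this
  -- If `v` is extremal on none of its three faces, each `F i` has a second point `x i` at the level
  -- of `v`. By genericity `x i` lies on no other `F j`, so the functional of `F j` is negative on
  -- `x i - v`.
  choose x hxF hxv hfx using hx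
  choose l hl hl' using fun i => exists_functional_of_isExposed (hF i).1.1 (hF i).2
  have hsub : ∀ i, x i ∈ P := fun i => (hF i).1.1.subset (hxF i)
  have hself : ∀ i, l i (x i - v) = 0 := fun i => by
    rw [map_sub, (hl' i _ (hsub i)).2 (hxF i), sub_self]
  have hneg : ∀ i j, i ≠ j → l i (x j - v) < 0 := fun i j hij => by
    rw [map_sub, sub_neg]
    refine lt_of_le_of_ne (hl i _ (hsub j)) fun h => hxv j ?_
    exact hf _ (hF i).1 _ (hF j).1 (fun h => hij (hinj h)) ⟨(hl' i _ (hsub j)).1 h, hxF j⟩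
      ⟨(hF i).2, (hF j).2⟩ (hfx j)
  have hker : Module.finrank ℝ (LinearMap.ker f) < 3 := by
    have h := Submodule.finrank_lt (s := LinearMap.ker f)
      (fun h => hf0 (LinearMap.ker_eq_top.1 h))
    rwa [finrank_E3] at h
  -- Three vectors in a plane are dependent. Applying the functional of `F i` to the relation kills
  -- the `i`-th term, so the other two coefficients have opposite signs or both vanish; three
  -- numbers cannot have pairwise opposite signs.
  let u : Fin 3 → LinearMap.ker f := fun i => ⟨x i - v, by simp [hfx i]⟩
  have hdep : ¬ LinearIndependent ℝ u := fun h => by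
    have := h.fintype_card_le_finrank
    rw [Fintype.card_fin] at this
    omega
  obtain ⟨c, hc, i₀, hi₀⟩ := Fintype.not_linearIndependent_iff.1 hdep
  have hsum : c 0 • (x 0 - v) + c 1 • (x 1 - v) + c 2 • (x 2 - v) = 0 := by
    have := congrArg Subtype.val hc
    simpa [Fin.sum_univ_three, u] using this
  have hrel : ∀ i, c 0 * l i (x 0 - v) + c 1 * l i (x 1 - v) + c 2 * l i (x 2 - v) = 0 := by
    intro i
    have := congrArg (l i) hsum
    simpa only [map_add, map_smul, smul_eq_mul, map_zero] using this
  have h0 := hrel 0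
  have h1 := hrel 1
  have h2 := hrel 2
  rw [hself 0] at h0
  rw [hself 1] at h1
  rw [hself 2] at h2
  have opp : ∀ {a b p q : ℝ}, p < 0 → q < 0 → a * p + b * q = 0 →
      a * b ≤ 0 ∧ (a = 0 → b = 0) ∧ (b = 0 → a = 0) := by
    intro a b p q hp hq h
    refine ⟨?_, ?_, ?_⟩
    · by_contra hab
      rcases mul_pos_iff.1 (not_le.1 hab) with ⟨ha, hb⟩ | ⟨ha, hb⟩
      · nlinarith [mul_pos_of_neg_of_neg (neg_neg_of_pos ha) hp,
          mul_pos_of_neg_of_neg (neg_neg_of_pos hb) hq]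
      · nlinarith [mul_pos_of_neg_of_neg ha hp, mul_pos_of_neg_of_neg hb hq]
    · rintro rfl
      simpa [hq.ne] using h
    · rintro rfl
      simpa [hp.ne] using h
  obtain ⟨s₁, z₁, z₁'⟩ := opp (a := c 1) (b := c 2) (hneg 0 1 (by decide)) (hneg 0 2 (by decide)) (by linarith)
  obtain ⟨s₂, z₂, z₂'⟩ := opp (a := c 0) (b := c 2) (hneg 1 0 (by decide)) (hneg 1 2 (by decide)) (by linarith)
  obtain ⟨s₃, z₃, z₃'⟩ := opp (a := c 0) (b := c 1) (hneg 2 0 (by decide)) (hneg 2 1 (by decide)) (by linarith)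
  have hall : c 0 ≠ 0 ∧ c 1 ≠ 0 ∧ c 2 ≠ 0 := by
    have : ∀ i, c i ≠ 0 → c 0 ≠ 0 := by
      intro i hi
      fin_cases i
      · exact hi
      · exact fun h => hi (z₃ h)
      · exact fun h => hi (z₂ h)
    have h := this i₀ hi₀
    exact ⟨h, fun h' => h (z₃' h'), fun h' => h (z₂' h')⟩
  have p₁ := lt_of_le_of_ne s₁ (mul_ne_zero hall.2.1 hall.2.2)
  have p₂ := lt_of_le_of_ne s₂ (mul_ne_zero hall.1 hall.2.2)
  have p₃ := lt_of_le_of_ne s₃ (mul_ne_zero hall.1 hall.2.1)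
  have h₄ := mul_neg_of_pos_of_neg (mul_pos_of_neg_of_neg p₁ p₂) p₃
  nlinarith [sq_nonneg (c 0 * c 1 * c 2)]

theorem three_le_card_filter {Φ : Finset (Set E3)} (hP : IsPolyhedron P)
    (hΦ : ∀ F, F ∈ Φ ↔ F ∈ faces P) {v : E3} (hv : v ∈ vertices P) (p : Set E3 → Prop)
    [DecidablePred p] (hp : ∀ F ∈ faces P, v ∈ F → p F) : 3 ≤ (Φ.filter p).card := by
  obtain ⟨F, hinj, hF⟩ := exists_three_faces hP hv
  have h : (Finset.univ.map ⟨F, hinj⟩) ⊆ Φ.filter p := by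
    intro G hG
    obtain ⟨i, -, rfl⟩ := Finset.mem_map.1 hG
    exact Finset.mem_filter.2 ⟨(hΦ _).2 (hF i).1, hp _ (hF i).1 (hF i).2⟩
  simpa using Finset.card_le_card h

/-- The number of vertices is at most `2 * F - 4`, where `F` is the number of faces. -/
theorem card_vertices_add_four_le (hP : IsPolyhedron P) {V : Finset E3} {Φ : Finset (Set E3)}
    (hV : ∀ v, v ∈ V ↔ v ∈ vertices P) (hΦ : ∀ F, F ∈ Φ ↔ F ∈ faces P) :
    V.card + 4 ≤ 2 * Φ.card := by
  classical
  have hfin : (faces P).Finite := Φ.finite_toSet.subset fun F hF => (hΦ F).2 hF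
  obtain ⟨f, hinj, hf⟩ := exists_generic_functional hP hfin
  have hne : V.Nonempty := by
    obtain ⟨v, hv⟩ := hP.vertices_nonempty
    exact ⟨v, (hV v).2 hv⟩
  have hf0 : f ≠ 0 := by
    rintro rfl
    obtain ⟨v, hv⟩ := hP.vertices_nonempty
    refine hP.nontrivial.not_subset_singleton
      (hP.subset_of_vertices (convex_singleton v) fun w hw => hinj hw hv rfl)
  obtain ⟨t, ht, hmax⟩ := V.exists_max_image f hne
  obtain ⟨b, hb, hmin⟩ := V.exists_min_image f hne
  have hle : ∀ x ∈ P, f x ≤ f t := hP.subset_of_vertices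
    (convex_halfSpace_le f.isLinear _) fun w hw => hmax w ((hV w).2 hw)
  have hge : ∀ x ∈ P, f b ≤ f x := hP.subset_of_vertices
    (convex_halfSpace_ge f.isLinear _) fun w hw => hmin w ((hV w).2 hw)
  have htb : t ≠ b := by
    rintro rfl
    exact hP.nontrivial.not_subset_singleton (hP.subset_of_vertices (convex_singleton t)
      fun w hw => hinj hw ((hV t).1 ht)
        (le_antisymm (hmax w ((hV w).2 hw)) (hmin w ((hV w).2 hw))))
  let top : E3 → Set E3 → Prop := fun v F => v ∈ F ∧ ∀ x ∈ F, f x ≤ f v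
  let bot : E3 → Set E3 → Prop := fun v F => v ∈ F ∧ ∀ x ∈ F, f v ≤ f x
  have hsub : ∀ F ∈ Φ, F ⊆ P := fun F hF => ((hΦ F).1 hF).1.subset
  -- Double counting: `f` separates the vertices, so a face has at most one highest vertex.
  have htop : ∑ v ∈ V, (Φ.filter (top v)).card ≤ Φ.card := by
    have h := Finset.sum_card_bipartiteAbove_eq_sum_card_bipartiteBelow top (s := V) (t := Φ)
    simp only [Finset.bipartiteAbove, Finset.bipartiteBelow] at h
    rw [h, Finset.card_eq_sum_ones]
    refine Finset.sum_le_sum fun F _ => Finset.card_le_one.2 fun v hv w hw => ?_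
    obtain ⟨hvV, hvF, hv⟩ := Finset.mem_filter.1 hv
    obtain ⟨hwV, hwF, hw⟩ := Finset.mem_filter.1 hw
    exact hinj ((hV v).1 hvV) ((hV w).1 hwV) (le_antisymm (hw v hvF) (hv w hwF))
  have hbot : ∑ v ∈ V, (Φ.filter (bot v)).card ≤ Φ.card := by
    have h := Finset.sum_card_bipartiteAbove_eq_sum_card_bipartiteBelow bot (s := V) (t := Φ)
    simp only [Finset.bipartiteAbove, Finset.bipartiteBelow] at h
    rw [h, Finset.card_eq_sum_ones]
    refine Finset.sum_le_sum fun F _ => Finset.card_le_one.2 fun v hv w hw => ?_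
    obtain ⟨hvV, hvF, hv⟩ := Finset.mem_filter.1 hv
    obtain ⟨hwV, hwF, hw⟩ := Finset.mem_filter.1 hw
    exact hinj ((hV v).1 hvV) ((hV w).1 hwV) (le_antisymm (hv w hwF) (hw v hvF))
  -- One incidence for each vertex and two extra for each of `t` and `b`: this is the origin of the
  -- `4`.
  have hlow : ∀ v ∈ V, (1 + if v = t then 2 else 0) + (if v = b then 2 else 0) ≤
      (Φ.filter (top v)).card + (Φ.filter (bot v)).card := by
    intro v hv
    by_cases hvt : v = t
    · subst hvt
      have h := three_le_card_filter hP hΦ ((hV v).1 hv) (top v)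
        fun F hF hvF => ⟨hvF, fun x hx => hle x (hF.1.subset hx)⟩
      simp only [if_true, htb, if_false]
      omega
    by_cases hvb : v = b
    · subst hvb
      have h := three_le_card_filter hP hΦ ((hV v).1 hv) (bot v)
        fun F hF hvF => ⟨hvF, fun x hx => hge x (hF.1.subset hx)⟩
      simp only [if_true, hvt, if_false]
      omega
    simp only [hvt, hvb, if_false]
    obtain ⟨F, hF, hvF, h | h⟩ := exists_face_extremal hP hf0 hf ((hV v).1 hv)
    · have : 0 < (Φ.filter (top v)).card :=
        Finset.card_pos.2 ⟨F, Finset.mem_filter.2 ⟨(hΦ F).2 hF, hvF, h⟩⟩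
      omega
    · have : 0 < (Φ.filter (bot v)).card :=
        Finset.card_pos.2 ⟨F, Finset.mem_filter.2 ⟨(hΦ F).2 hF, hvF, h⟩⟩
      omega
  have hsum := Finset.sum_le_sum hlow
  simp only [Finset.sum_add_distrib, Finset.sum_ite_eq', ht, hb, if_true, Finset.sum_const,
    smul_eq_mul, mul_one] at hsum
  omega

/-- A polyhedron with at least eleven vertices has at least eight faces. -/
theorem IsPolyhedron.eight_le_faceCount (hP : IsPolyhedron P) (h : 11 ≤ vertexCount P) :
    8 ≤ faceCount P := by
  by_contra hlt
  rw [not_le, faceCount] at hlt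
  have hfin : (faces P).Finite := Set.encard_lt_top_iff.1 (hlt.trans_le le_top)
  have hcard := card_vertices_add_four_le hP (V := hP.finite_vertices.toFinset)
    (Φ := hfin.toFinset) (fun v => hP.finite_vertices.mem_toFinset) fun F => hfin.mem_toFinset
  rw [vertexCount, hP.finite_vertices.encard_eq_coe_toFinset_card] at h
  rw [hfin.encard_eq_coe_toFinset_card] at hlt
  have h₁ : 11 ≤ hP.finite_vertices.toFinset.card := by exact_mod_cast h
  have h₂ : hfin.toFinset.card < 8 := by exact_mod_cast hlt
  omega

end Counting

/-! ### Certificates for the faces and vertices of a simple polytope. -/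

section Simple

/-- The points `p i` span a simple polytope with the facet normals `n f`: the facets through `p i` are
`φ i k`, and `p (e i k)` is the other end of the edge at `p i` that leaves the facet `φ i k`. -/
structure IsSimplePolytope {ι κ : Type*} (p : ι → E3) (n : κ → E3) (b : κ → ℝ) (φ : ι → Fin 3 → κ)
    (e : ι → Fin 3 → ι) : Prop where
  le : ∀ f i, ⟪n f, p i⟫ ≤ b f
  eq : ∀ i k, ⟪n (φ i k), p i⟫ = b (φ i k)
  eq_edge : ∀ i k l, k ≠ l → ⟪n (φ i k), p (e i l)⟫ = b (φ i k)
  lt_edge : ∀ i k, ⟪n (φ i k), p (e i k)⟫ < b (φ i k)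

namespace IsSimplePolytope

variable {ι κ : Type*} {p : ι → E3} {n : κ → E3} {b : κ → ℝ} {φ : ι → Fin 3 → κ}
  {e : ι → Fin 3 → ι}

theorem inner_edge_of_ne (h : IsSimplePolytope p n b φ e) (i : ι) {k l : Fin 3} (hkl : k ≠ l) :
    ⟪n (φ i k), p (e i l) - p i⟫ = 0 := by
  rw [inner_sub_right, h.eq_edge i k l hkl, h.eq, sub_self]

theorem inner_edge_self (h : IsSimplePolytope p n b φ e) (i : ι) (k : Fin 3) :
    ⟪n (φ i k), p (e i k) - p i⟫ < 0 := by
  rw [inner_sub_right, h.eq]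
  exact sub_neg.2 (h.lt_edge i k)

/-- Up to negative factors, the three normals at `p i` form the dual basis of the three edge
vectors, so each normal reads off one coordinate. -/
theorem inner_sum_edges (h : IsSimplePolytope p n b φ e) (i : ι) (c : Fin 3 → ℝ) (k : Fin 3) :
    ⟪n (φ i k), ∑ l, c l • (p (e i l) - p i)⟫ = c k * ⟪n (φ i k), p (e i k) - p i⟫ := by
  rw [inner_sum, Finset.sum_eq_single k]
  · rw [real_inner_smul_right]
  · intro l _ hl
    rw [real_inner_smul_right, h.inner_edge_of_ne i hl.symm, mul_zero]
  · simp

theorem linearIndependent_edges (h : IsSimplePolytope p n b φ e) (i : ι) :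
    LinearIndependent ℝ fun k => p (e i k) - p i := by
  rw [Fintype.linearIndependent_iff]
  intro c hc k
  have := h.inner_sum_edges i c k
  rw [hc, inner_zero_right] at this
  exact (mul_eq_zero.1 this.symm).resolve_right (h.inner_edge_self i k).ne

theorem span_edges (h : IsSimplePolytope p n b φ e) (i : ι) :
    Submodule.span ℝ (Set.range fun k => p (e i k) - p i) = ⊤ :=
  (h.linearIndependent_edges i).span_eq_top_of_card_eq_finrank' (by simp)

theorem exists_eq_sum_edges (h : IsSimplePolytope p n b φ e) (i : ι) (x : E3) :
    ∃ c : Fin 3 → ℝ, x = ∑ k, c k • (p (e i k) - p i) := by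
  have hx : x ∈ Submodule.span ℝ (Set.range fun k => p (e i k) - p i) := by
    rw [h.span_edges]; trivial
  obtain ⟨c, hc⟩ := (Submodule.mem_span_range_iff_exists_fun ℝ).1 hx
  exact ⟨c, hc.symm⟩

theorem eq_zero_of_inner (h : IsSimplePolytope p n b φ e) (i : ι) {x : E3}
    (hx : ∀ k, ⟪n (φ i k), x⟫ = 0) : x = 0 := by
  obtain ⟨c, rfl⟩ := h.exists_eq_sum_edges i x
  refine Finset.sum_eq_zero fun k _ => ?_
  have := hx k
  rw [h.inner_sum_edges] at this
  rw [(mul_eq_zero.1 this).resolve_right (h.inner_edge_self i k).ne, zero_smul]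

theorem inner_le (h : IsSimplePolytope p n b φ e) (f : κ) {x : E3}
    (hx : x ∈ convexHull ℝ (Set.range p)) : ⟪n f, x⟫ ≤ b f := by
  have hconv : Convex ℝ {x : E3 | ⟪n f, x⟫ ≤ b f} :=
    convex_halfSpace_le (innerSL ℝ (n f)).toLinearMap.isLinear _
  exact convexHull_min (Set.range_subset_iff.2 (h.le f)) hconv hx

theorem mem_convexHull (p : ι → E3) (i : ι) : p i ∈ convexHull ℝ (Set.range p) :=
  subset_convexHull ℝ _ ⟨i, rfl⟩

/-- If `p i` is inside a segment of the polytope, its three tight inequalities are tight at both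
ends, and they have only one common solution. -/
theorem vertices_eq (h : IsSimplePolytope p n b φ e) :
    vertices (convexHull ℝ (Set.range p)) = Set.range p := by
  refine Set.Subset.antisymm extremePoints_convexHull_subset ?_
  rintro _ ⟨i, rfl⟩
  rw [vertices, mem_extremePoints]
  refine ⟨mem_convexHull p i, fun x hx y hy hxy => ?_⟩
  obtain ⟨s, t, hs, ht, hst, hsum⟩ := hxy
  have key : ∀ k, ⟪n (φ i k), x⟫ = b (φ i k) ∧ ⟪n (φ i k), y⟫ = b (φ i k) := by
    intro k
    have h₁ := h.inner_le (φ i k) hx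
    have h₂ := h.inner_le (φ i k) hy
    have h₃ := h.eq i k
    rw [← hsum, inner_add_right, real_inner_smul_right, real_inner_smul_right] at h₃
    obtain rfl : t = 1 - s := by linarith
    constructor <;> nlinarith
  constructor
  · refine sub_eq_zero.1 (h.eq_zero_of_inner i fun k => ?_)
    rw [inner_sub_right, (key k).1, h.eq, sub_self]
  · refine sub_eq_zero.1 (h.eq_zero_of_inner i fun k => ?_)
    rw [inner_sub_right, (key k).2, h.eq, sub_self]

theorem isPolyhedron [Finite ι] [Nonempty ι] (h : IsSimplePolytope p n b φ e) :
    IsPolyhedron (convexHull ℝ (Set.range p)) := by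
  refine ⟨Set.range p, Set.finite_range p, rfl, ?_⟩
  rw [interior_convexHull_nonempty_iff_affineSpan_eq_top,
    ← AffineSubspace.direction_eq_top_iff_of_nonempty
      ((affineSpan_nonempty ℝ).2 (Set.range_nonempty p)), direction_affineSpan, eq_top_iff]
  have i := Classical.arbitrary ι
  rw [← h.span_edges i, Submodule.span_le]
  rintro _ ⟨k, rfl⟩
  exact vsub_mem_vectorSpan ℝ ⟨_, rfl⟩ ⟨_, rfl⟩

theorem facet_mem_faces (h : IsSimplePolytope p n b φ e) (i : ι) (k : Fin 3) :
    {x ∈ convexHull ℝ (Set.range p) | ⟪n (φ i k), x⟫ = b (φ i k)} ∈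
      faces (convexHull ℝ (Set.range p)) := by
  set F := {x ∈ convexHull ℝ (Set.range p) | ⟪n (φ i k), x⟫ = b (φ i k)} with hF
  have hi : p i ∈ F := ⟨mem_convexHull p i, h.eq i k⟩
  refine ⟨fun _ => ⟨innerSL ℝ (n (φ i k)), ?_⟩, le_antisymm ?_ ?_⟩
  · ext x
    simp only [hF, Set.mem_ofPred_eq, innerSL_apply_apply]
    refine and_congr_right fun hx => ⟨fun hx' y hy => ?_, fun hx' => ?_⟩
    · rw [hx']
      exact h.inner_le _ hy
    · exact le_antisymm (h.inner_le _ hx) (h.eq i k ▸ hx' _ (mem_convexHull p i))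
  · have hn0 : n (φ i k) ≠ 0 := by
      intro h0
      have := h.inner_edge_self i k
      rw [h0, inner_zero_left] at this
      exact lt_irrefl _ this
    have hsub : vectorSpan ℝ F ≤ (Submodule.span ℝ {n (φ i k)})ᗮ := by
      rw [vectorSpan_eq_span_vsub_set_right ℝ hi, Submodule.span_le]
      rintro _ ⟨y, hy, rfl⟩
      refine Submodule.mem_orthogonal_singleton_iff_inner_right.2 ?_
      change ⟪n (φ i k), y - p i⟫ = 0
      rw [inner_sub_right, hy.2, h.eq, sub_self]
    have h1 := Submodule.finrank_mono hsub
    have h2 := Submodule.finrank_add_finrank_orthogonal (Submodule.span ℝ {n (φ i k)})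
    rw [finrank_span_singleton hn0, finrank_E3] at h2
    rw [dim]
    omega
  · have hli := (h.linearIndependent_edges i).comp (fun l : {l : Fin 3 // l ≠ k} => (l : Fin 3))
      Subtype.val_injective
    have hcard : Fintype.card {l : Fin 3 // l ≠ k} = 2 := by simp
    rw [← hcard, ← finrank_span_eq_card hli, dim]
    refine Submodule.finrank_mono (Submodule.span_le.2 ?_)
    rintro _ ⟨⟨l, hl⟩, rfl⟩
    exact vsub_mem_vectorSpan ℝ ⟨mem_convexHull p _, h.eq_edge i k l hl.symm⟩ hi

/-- At a vertex `p i` of `F` the polytope lies in the cone of the three edges, and the exposing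
functional is nonpositive on each edge. Hence `F` consists of the points whose coordinates vanish
along the edges where it is negative. Dimension two means that there is exactly one such edge, and
`F` is the facet left by it. -/
theorem eq_facet_of_mem_faces [Finite ι] [Nonempty ι] (h : IsSimplePolytope p n b φ e) {F : Set E3}
    (hF : F ∈ faces (convexHull ℝ (Set.range p))) :
    ∃ i k, F = {x ∈ convexHull ℝ (Set.range p) | ⟪n (φ i k), x⟫ = b (φ i k)} := by
  obtain ⟨hexp, hdim⟩ := hF
  obtain ⟨y, hy⟩ : F.Nonempty := by
    rw [Set.nonempty_iff_ne_empty]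
    rintro rfl
    rw [dim_empty] at hdim
    omega
  obtain ⟨l, hle, hl⟩ := exists_functional_of_isExposed hexp hy
  obtain ⟨i, hi⟩ := Finite.exists_max fun i => l (p i)
  have hmax : ∀ x ∈ convexHull ℝ (Set.range p), l x ≤ l (p i) := fun x hx =>
    convexHull_min (Set.range_subset_iff.2 hi)
      (convex_halfSpace_le l.toLinearMap.isLinear _) hx
  have hiF : p i ∈ F := (hl _ (mem_convexHull p i)).1
    (le_antisymm (hle _ (mem_convexHull p i)) (hmax y (hexp.subset hy)))
  have hedge : ∀ k, l (p (e i k) - p i) ≤ 0 := fun k => by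
    rw [map_sub, sub_nonpos]; exact hi _
  have hcoord : ∀ x ∈ convexHull ℝ (Set.range p), ∃ c : Fin 3 → ℝ, (∀ k, 0 ≤ c k) ∧
      (x - p i = ∑ k, c k • (p (e i k) - p i)) ∧ (∀ k, c k = 0 ↔ ⟪n (φ i k), x⟫ = b (φ i k)) ∧
      (x ∈ F ↔ ∀ k, c k * l (p (e i k) - p i) = 0) := by
    intro x hx
    obtain ⟨c, hc⟩ := h.exists_eq_sum_edges i (x - p i)
    have hck : ∀ k, ⟪n (φ i k), x⟫ - b (φ i k) = c k * ⟪n (φ i k), p (e i k) - p i⟫ := by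
      intro k
      rw [← h.inner_sum_edges, ← hc, inner_sub_right, h.eq]
    have hc0 : ∀ k, 0 ≤ c k := by
      intro k
      have h₁ := h.inner_le (φ i k) hx
      have h₂ := h.inner_edge_self i k
      by_contra hneg
      have := mul_pos_of_neg_of_neg (not_le.1 hneg) h₂
      linarith [hck k]
    refine ⟨c, hc0, hc, fun k => ?_, ?_⟩
    · rw [← sub_eq_zero (b := b (φ i k)), hck, mul_eq_zero,
        or_iff_left (h.inner_edge_self i k).ne]
    · have hsum : l x - l (p i) = ∑ k, c k * l (p (e i k) - p i) := by
        rw [← map_sub, hc, map_sum]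
        simp
      have hyi : l (p i) = l y := (hl _ (mem_convexHull p i)).2 hiF
      rw [← hl x hx, ← hyi, ← sub_eq_zero, hsum,
        Finset.sum_eq_zero_iff_of_nonpos fun k _ => mul_nonpos_of_nonneg_of_nonpos (hc0 k) (hedge k)]
      simp
  obtain ⟨k, hk⟩ : ∃ k, l (p (e i k) - p i) ≠ 0 := by
    by_contra! hall
    have hmem : ∀ j, p j ∈ F := fun j => by
      obtain ⟨c, -, -, -, hc⟩ := hcoord _ (mem_convexHull p j)
      exact hc.2 fun k => by rw [hall k, mul_zero]
    have htop : vectorSpan ℝ F = ⊤ := by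
      rw [eq_top_iff, ← h.span_edges i, Submodule.span_le]
      rintro _ ⟨k, rfl⟩
      exact vsub_mem_vectorSpan ℝ (hmem _) (hmem _)
    rw [dim, htop, finrank_top, finrank_E3] at hdim
    omega
  have huniq : ∀ k', k' ≠ k → l (p (e i k') - p i) = 0 := by
    intro k' hkk'
    by_contra hk'
    have hthird : ∀ k k' : Fin 3, k' ≠ k → ∃ m, ∀ j, j = k ∨ j = k' ∨ j = m := by decide
    obtain ⟨m, hm⟩ := hthird k k' hkk'
    have hle : vectorSpan ℝ F ≤ Submodule.span ℝ {p (e i m) - p i} := by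
      rw [vectorSpan_eq_span_vsub_set_right ℝ hiF, Submodule.span_le]
      rintro _ ⟨x, hx, rfl⟩
      obtain ⟨c, -, hc, -, hcF⟩ := hcoord x (hexp.subset hx)
      have hz := hcF.1 hx
      have h₁ := (mul_eq_zero.1 (hz k)).resolve_right hk
      have h₂ := (mul_eq_zero.1 (hz k')).resolve_right hk'
      change x - p i ∈ Submodule.span ℝ {p (e i m) - p i}
      rw [hc, Finset.sum_eq_single m]
      · exact Submodule.smul_mem _ _ (Submodule.mem_span_singleton_self _)
      · intro j _ hj
        rcases hm j with rfl | rfl | rfl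
        · rw [h₁, zero_smul]
        · rw [h₂, zero_smul]
        · exact absurd rfl hj
      · simp
    have h₁ := Submodule.finrank_mono hle
    have h₂ := finrank_span_finset_le_card (R := ℝ) ({p (e i m) - p i} : Finset E3)
    rw [Finset.coe_singleton, Finset.card_singleton] at h₂
    rw [dim] at hdim
    have h₃ := h₁.trans h₂
    omega
  refine ⟨i, k, Set.ext fun x => ⟨fun hx => ?_, fun ⟨hx, hxk⟩ => ?_⟩⟩
  · obtain ⟨c, -, -, hc, hcF⟩ := hcoord x (hexp.subset hx)
    exact ⟨hexp.subset hx, (hc k).1 ((mul_eq_zero.1 (hcF.1 hx k)).resolve_right hk)⟩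
  · obtain ⟨c, -, -, hc, hcF⟩ := hcoord x hx
    refine hcF.2 fun k' => ?_
    by_cases hkk' : k' = k
    · rw [hkk', (hc k).2 hxk, zero_mul]
    · rw [huniq k' hkk', mul_zero]

theorem faceCount_eq [Finite ι] [Nonempty ι] [Fintype κ] (h : IsSimplePolytope p n b φ e)
    (hsurj : ∀ f, ∃ i k, φ i k = f)
    (hsep : ∀ f g, f ≠ g → ∃ i, ⟪n f, p i⟫ = b f ∧ ⟪n g, p i⟫ ≠ b g) :
    faceCount (convexHull ℝ (Set.range p)) = Fintype.card κ := by
  have hfaces : faces (convexHull ℝ (Set.range p)) =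
      Set.range fun f => {x ∈ convexHull ℝ (Set.range p) | ⟪n f, x⟫ = b f} := by
    ext F
    constructor
    · intro hF
      obtain ⟨i, k, rfl⟩ := h.eq_facet_of_mem_faces hF
      exact ⟨φ i k, rfl⟩
    · rintro ⟨f, rfl⟩
      obtain ⟨i, k, rfl⟩ := hsurj f
      exact h.facet_mem_faces i k
  have hinj : Function.Injective
      fun f => {x ∈ convexHull ℝ (Set.range p) | ⟪n f, x⟫ = b f} := by
    intro f g hfg
    by_contra hne
    obtain ⟨i, h₁, h₂⟩ := hsep f g hne
    have : p i ∈ {x ∈ convexHull ℝ (Set.range p) | ⟪n f, x⟫ = b f} := ⟨mem_convexHull p i, h₁⟩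
    exact h₂ ((Set.ext_iff.1 hfg (p i)).1 this).2
  rw [faceCount, hfaces, ← Set.image_univ, hinj.encard_image, Set.encard_univ,
    ENat.card_eq_coe_fintype_card]

end IsSimplePolytope

/-- A polyhedron is mono-unstable if, seen from the center, exactly one vertex has all others on the
near side of its perpendicular plane. -/
theorem unstableCount_eq_one {P : Set E3} (hP : IsPolyhedron P) {o r : E3} (hr : r ∈ vertices P)
    (hmax : ∀ w ∈ vertices P, w ≠ r → ⟪r - o, w - r⟫ < 0)
    (h : ∀ v ∈ vertices P, v ≠ r → ∃ w ∈ vertices P, w ≠ v ∧ 0 ≤ ⟪v - o, w - v⟫) :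
    unstableCount P o = 1 := by
  refine Set.encard_eq_one.2 ⟨r, Set.Subset.antisymm (fun q hq => ?_) ?_⟩
  · obtain ⟨hqP, hlt⟩ := (isUnstableEquilibrium_iff hP).1 hq
    have hqv : q ∈ vertices P := by
      by_contra hqv
      have hconv : Convex ℝ {x : E3 | ⟪q - o, x⟫ < ⟪q - o, q⟫} :=
        convex_halfSpace_lt (innerSL ℝ (q - o)).toLinearMap.isLinear _
      refine lt_irrefl ⟪q - o, q⟫ (hP.subset_of_vertices hconv (fun w hw => ?_) hqP :)
      have := hlt w (extremePoints_subset hw) fun h => hqv (h ▸ hw)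
      rwa [inner_sub_right, sub_neg] at this
    by_contra hqr
    obtain ⟨w, hw, hwq, hle⟩ := h q hqv hqr
    exact absurd (hlt w (extremePoints_subset hw) hwq) (not_lt.2 hle)
  · rintro _ rfl
    exact isUnstableEquilibrium_of_vertices hP (extremePoints_subset hr) hmax

end Simple

/-! ### The example with twelve vertices and eight faces. -/

section Example

/-- The numerators of the coordinates of the vertices of the example. -/
def vertexNum : Fin 12 → Fin 3 → ℤ :=
    ![![-1, -3, 21], ![-17, -16, 7], ![253, -106, 33], ![169, 2, 289], ![53, -30, 1], ![224,
    -35, 245], ![191, -44, 157], ![13, -40, -1], ![197, -74, 57], ![54, -18, 24], ![13, -14,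
    -1], ![101, -42, 31]]

/-- The common denominators of the coordinates of the vertices of the example. -/
def vertexDen : Fin 12 → ℤ :=
  ![30, 20, 390, 485, 86, 451, 334, 50, 294, 83, 24, 152]

/-- The outer normals of the faces of the example. -/
def faceNormal : Fin 8 → Fin 3 → ℤ :=
    ![![-6, 12, -10], ![3, -8, 9], ![5, 11, -3], ![7, -2, -1], ![3, -1, 10], ![-2, 2, -6], ![5,
    -6, 5], ![8, -1, 2]]

/-- The right hand sides of the inequalities defining the faces of the example. -/
def faceOffset : Fin 8 → ℤ :=
  ![-8, 7, 0, 5, 7, -2, 6, 6]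

/-- The faces through the vertices of the example. -/
def vertexFaces : Fin 12 → Fin 3 → Fin 8 :=
    ![![0, 1, 4], ![0, 1, 5], ![0, 2, 3], ![0, 2, 4], ![0, 3, 5], ![1, 2, 4], ![1, 2, 6], ![1,
    5, 6], ![2, 3, 7], ![2, 6, 7], ![3, 5, 6], ![3, 6, 7]]

/-- The neighbours of the vertices of the example along the edges that leave the faces listed in
`vertexFaces`. -/
def vertexNeighbors : Fin 12 → Fin 3 → Fin 12 :=
    ![![5, 3, 1], ![7, 4, 0], ![8, 4, 3], ![5, 0, 2], ![10, 1, 2], ![3, 0, 6], ![9, 7, 5],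
    ![10, 6, 1], ![11, 9, 2], ![11, 8, 6], ![7, 11, 4], ![9, 8, 10]]

/-- A vertex beyond the plane through the given vertex that is perpendicular to the segment from the
center of mass; this is meaningless for vertex 1. -/
def vertexParent : Fin 12 → Fin 12 :=
  ![1, 1, 4, 0, 10, 3, 5, 1, 2, 8, 7, 2]

/-- The vertices of the example. -/
noncomputable def vertexPoint (i : Fin 12) : E3 :=
  WithLp.toLp 2 fun k => (vertexNum i k : ℝ) / vertexDen i

/-- The outer normals of the faces of the example, as vectors. -/
noncomputable def normalVector (f : Fin 8) : E3 :=
  WithLp.toLp 2 fun k => (faceNormal f k : ℝ)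

theorem inner_eq_sum (x y : E3) : ⟪x, y⟫ = x 0 * y 0 + x 1 * y 1 + x 2 * y 2 := by
  simp [PiLp.inner_apply, Fin.sum_univ_three, mul_comm]

theorem vertexDen_pos (i : Fin 12) : 0 < vertexDen i := by
  revert i; decide

/-- The numerator of the difference of the two sides of the inequality of a face at a vertex. -/
def slack (f : Fin 8) (i : Fin 12) : ℤ :=
  faceOffset f * vertexDen i - (faceNormal f 0 * vertexNum i 0 + faceNormal f 1 * vertexNum i 1 +
    faceNormal f 2 * vertexNum i 2)

theorem inner_normalVector (f : Fin 8) (i : Fin 12) :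
    ⟪normalVector f, vertexPoint i⟫ = faceOffset f - (slack f i : ℝ) / vertexDen i := by
  have h : (vertexDen i : ℝ) ≠ 0 := by exact_mod_cast (vertexDen_pos i).ne'
  rw [inner_eq_sum]
  simp only [normalVector, vertexPoint, slack]
  push_cast
  field_simp
  ring

theorem inner_normalVector_le_iff (f : Fin 8) (i : Fin 12) :
    ⟪normalVector f, vertexPoint i⟫ ≤ faceOffset f ↔ 0 ≤ slack f i := by
  have h : (0 : ℝ) < vertexDen i := by exact_mod_cast vertexDen_pos i
  rw [inner_normalVector, sub_le_self_iff, le_div_iff₀ h, zero_mul]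
  exact_mod_cast Iff.rfl

theorem inner_normalVector_eq_iff (f : Fin 8) (i : Fin 12) :
    ⟪normalVector f, vertexPoint i⟫ = faceOffset f ↔ slack f i = 0 := by
  have h : (vertexDen i : ℝ) ≠ 0 := by exact_mod_cast (vertexDen_pos i).ne'
  rw [inner_normalVector, sub_eq_self, div_eq_zero_iff, or_iff_left h]
  exact_mod_cast Iff.rfl

theorem isSimplePolytope_example :
    IsSimplePolytope vertexPoint normalVector (fun f => (faceOffset f : ℝ)) vertexFaces
      vertexNeighbors where
  le f i := (inner_normalVector_le_iff f i).2 (by revert f i; decide)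
  eq i k := (inner_normalVector_eq_iff _ i).2 (by revert i k; decide)
  eq_edge i k l hkl := (inner_normalVector_eq_iff _ _).2 (by revert i k l; decide)
  lt_edge i k := lt_of_le_of_ne ((inner_normalVector_le_iff _ _).2 (by revert i k; decide))
    fun h => absurd ((inner_normalVector_eq_iff _ _).1 h) (by clear h; revert i k; decide)

theorem vertexPoint_injective : Function.Injective vertexPoint := by
  have key : ∀ i j : Fin 12, (∀ k, vertexNum i k * vertexDen j = vertexNum j k * vertexDen i) →
      i = j := by decide
  intro i j hij
  refine key i j fun k => ?_
  have hi : (vertexDen i : ℝ) ≠ 0 := by exact_mod_cast (vertexDen_pos i).ne'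
  have hj : (vertexDen j : ℝ) ≠ 0 := by exact_mod_cast (vertexDen_pos j).ne'
  have h : (vertexNum i k : ℝ) / vertexDen i = vertexNum j k / vertexDen j :=
    congrArg (fun x : E3 => x k) hij
  rw [div_eq_div_iff hi hj] at h
  exact_mod_cast h

/-- The example, a polyhedron with twelve vertices and eight faces. -/
def examplePolyhedron : Set E3 :=
  convexHull ℝ (Set.range vertexPoint)

theorem faceCount_examplePolyhedron : faceCount examplePolyhedron = 8 := by
  have h := isSimplePolytope_example.faceCount_eq (by decide) (fun f g hfg => by
    have key : ∀ f g : Fin 8, f ≠ g → ∃ i, slack f i = 0 ∧ slack g i ≠ 0 := by decide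
    obtain ⟨i, h₁, h₂⟩ := key f g hfg
    exact ⟨i, (inner_normalVector_eq_iff f i).2 h₁, fun h => h₂ ((inner_normalVector_eq_iff g i).1 h)⟩)
  rw [examplePolyhedron, h]
  rfl

theorem skeletonCenter_examplePolyhedron :
    skeletonCenter examplePolyhedron = (12 : ℝ)⁻¹ • ∑ i, vertexPoint i := by
  rw [skeletonCenter, examplePolyhedron, isSimplePolytope_example.vertices_eq,
    finsum_mem_range vertexPoint_injective, finsum_eq_sum_of_fintype, ← Set.image_univ,
    Set.ncard_image_of_injective _ vertexPoint_injective, Set.ncard_univ, Nat.card_fin]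
  norm_num

/-- A common denominator of the coordinates of all vertices of the example. -/
def commonDen : ℤ :=
  189345757586785800

/-- The coordinates of the vertices of the example, multiplied by `commonDen`. -/
def scaledCoord (i : Fin 12) (k : Fin 3) : ℤ :=
  vertexNum i k * (commonDen / vertexDen i)

/-- The inner product of the vectors from the center of mass to the vertex `i` and from the vertex
`i` to the vertex `j`, multiplied by `12 * commonDen ^ 2`. -/
def excess (i j : Fin 12) : ℤ :=
  ∑ k, (12 * scaledCoord i k - ∑ m, scaledCoord m k) * (scaledCoord j k - scaledCoord i k)

theorem commonDen_cast_pos : (0 : ℝ) < commonDen := by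
  norm_num [commonDen]

theorem vertexPoint_apply (i : Fin 12) (k : Fin 3) :
    vertexPoint i k = (scaledCoord i k : ℝ) / commonDen := by
  -- The integer division in `scaledCoord` is exact.
  have h : commonDen / vertexDen i * vertexDen i = commonDen := by revert i; decide
  have h₁ : (vertexDen i : ℝ) ≠ 0 := by exact_mod_cast (vertexDen_pos i).ne'
  have h₂ : ((vertexNum i k * commonDen : ℤ) : ℝ) = (scaledCoord i k * vertexDen i : ℤ) := by
    rw [scaledCoord, mul_assoc, h]
  push_cast at h₂
  exact (div_eq_div_iff h₁ commonDen_cast_pos.ne').2 h₂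

theorem inner_sub_skeletonCenter (i j : Fin 12) :
    ⟪vertexPoint i - skeletonCenter examplePolyhedron, vertexPoint j - vertexPoint i⟫ =
      (excess i j : ℝ) / (12 * commonDen ^ 2) := by
  have h : ∀ k, (∑ m, vertexPoint m) k = ((∑ m, scaledCoord m k : ℤ) : ℝ) / commonDen :=
    fun k => by simp [vertexPoint_apply, Finset.sum_div]
  have hD := commonDen_cast_pos.ne'
  rw [skeletonCenter_examplePolyhedron, inner_eq_sum]
  simp only [PiLp.sub_apply, PiLp.smul_apply, smul_eq_mul, h, vertexPoint_apply, excess,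
    Fin.sum_univ_three]
  push_cast
  field_simp

theorem excess_neg : ∀ j, j ≠ 1 → excess 1 j < 0 := by
  decide +kernel

/-- The parents form a tree rooted at vertex 1: a chain 0, 3, 5, 6 and a chain 7, 10, 4, 2, 8, 9,
with 11 hanging from 2. -/
theorem excess_nonneg : ∀ i, i ≠ 1 → vertexParent i ≠ i ∧ 0 ≤ excess i (vertexParent i) := by
  decide +kernel

theorem isMonoUnstableSkeleton_examplePolyhedron : IsMonoUnstableSkeleton examplePolyhedron := by
  have hP : IsPolyhedron examplePolyhedron := isSimplePolytope_example.isPolyhedron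
  have hV : vertices examplePolyhedron = Set.range vertexPoint :=
    isSimplePolytope_example.vertices_eq
  refine ⟨hP, unstableCount_eq_one hP (r := vertexPoint 1) (hV ▸ ⟨1, rfl⟩) ?_ ?_⟩
  · rw [hV]
    rintro _ ⟨j, rfl⟩ hj
    have h : (excess 1 j : ℝ) < 0 := by
      exact_mod_cast excess_neg j fun h => hj (by rw [h])
    rw [inner_sub_skeletonCenter]
    exact div_neg_of_neg_of_pos h (mul_pos (by norm_num) (pow_pos commonDen_cast_pos 2))
  · rw [hV]
    rintro _ ⟨i, rfl⟩ hi
    obtain ⟨hne, h⟩ := excess_nonneg i fun h => hi (by rw [h])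
    refine ⟨_, ⟨vertexParent i, rfl⟩, fun h => hne (vertexPoint_injective h), ?_⟩
    have h' : (0 : ℝ) ≤ excess i (vertexParent i) := by exact_mod_cast h
    rw [inner_sub_skeletonCenter]
    exact div_nonneg h' (mul_pos (by norm_num) (pow_pos commonDen_cast_pos 2)).le

end Example

end MonoUnstable

theorem mainTheorem4 :
    (∀ P : Set MonoUnstable.E3, MonoUnstable.IsPolyhedron P →
        11 ≤ MonoUnstable.vertexCount P → 8 ≤ MonoUnstable.faceCount P) ∧
      IsLeast {n : ℕ∞ | ∃ P : Set MonoUnstable.E3,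
        MonoUnstable.IsMonoUnstableSkeleton P ∧ MonoUnstable.faceCount P = n} 8 := by
  refine ⟨fun P hP h => hP.eight_le_faceCount h, ⟨MonoUnstable.examplePolyhedron,
    MonoUnstable.isMonoUnstableSkeleton_examplePolyhedron,
    MonoUnstable.faceCount_examplePolyhedron⟩, ?_⟩
  rintro _ ⟨P, hP, rfl⟩
  exact hP.1.eight_le_faceCount hP.eleven_le_vertexCount
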